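/- Theorem (Universal coefficient theorem). Let $\mathcal G$ be an ample groupoid, i.e. a topological groupoid that is étale (its source map is a local homeomorphism), locally compact, Hausdorff and totally disconnected. For $n\ge 0$ let $\mathcal G_n$ be the space of composable $n$-tuples of arrows ($\mathcal G_0=\mathcal G^{(0)}$ is the unit space), with the face maps $d_0,\dots,d_n\colon\mathcal G_n\to\mathcal G_{n-1}$ of the nerve. For an abelian topological group $A$ let $C_c(\mathcal G_n,A)$ be the group of compactly supported continuous functions $\mathcal G_n\to A$, let $(\phi_*f)(y)=\sum_{\phi(x)=y}f(x)$ denote the pushforward along a local homeomorphism $\phi$, and let $H_n(\mathcal G;A)$ be the $n$-th homology group of the Moore complex $C_c(\mathcal G_\bullet,A)$ with differential $\partial_n=\sum_{i=0}^n(-1)^i(d_i)_*$ for $n\ge1$ and $\partial_0=0$; put $H_{-1}(\mathcal G;\mathbb Z)=0$. Then for every $n\ge 0$ there are homomorphisms $\kappa_n^{\mathcal G}$, $\iota_n^{\mathcal G}$, defined for all ample groupoids $\mathcal G$ and all discrete abelian groups $A$, such that $$0\longrightarrow H_n(\mathcal G;\mathbb Z)\otimes_{\mathbb Z}A\xrightarrow{\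 \kappa_n^{\mathcal G}\ }H_n(\mathcal G;A)\xrightarrow{\ \iota_n^{\mathcal G}\ }\operatorname{Tor}_1^{\mathbb Z}\bigl(H_{n-1}(\mathcal G;\mathbb Z),A\bigr)\longrightarrow 0$$ is exact, natural in $A$ with respect to group homomorphisms, and natural in $\mathcal G$ with respect to étale homomorphisms $\mathcal G\to\mathcal H$ (groupoid homomorphisms that are local homeomorphisms on the spaces of arrows), which act on homology through the pushforwards along $\mathcal G_n\to\mathcal H_n$. -/

import Mathlib

open CategoryTheory Topology
open scoped CompactlySupported

universe u v

namespace AmpleUCT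

set_option linter.unusedSectionVars false

section LocalHomeo

variable {X Y Z B : Type*} [TopologicalSpace X] [TopologicalSpace Y] [TopologicalSpace Z]
  [TopologicalSpace B]

/-- The base change of a local homeomorphism is a local homeomorphism. -/
theorem isLocalHomeomorph_of_pullback {p : Z → X} {q : Z → Y} {f : X → B} {g : Y → B}
    (hf : IsLocalHomeomorph f) (hg : Continuous g)
    (hind : IsInducing fun z => (p z, q z))
    (hinj : ∀ z z', p z = p z' → q z = q z' → z = z')
    (hcomm : ∀ z, f (p z) = g (q z))
    (hsurj : ∀ x y, f x = g y → ∃ z, p z = x ∧ q z = y) :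
    IsLocalHomeomorph q := by
  have hc := hind.continuous
  have hp : Continuous p := continuous_fst.comp hc
  have hq : Continuous q := continuous_snd.comp hc
  rw [isLocalHomeomorph_iff_isOpenEmbedding_restrict]
  intro z
  obtain ⟨e, he, rfl⟩ := hf (p z)
  refine ⟨p ⁻¹' e.source, (e.open_source.preimage hp).mem_nhds he, ?_⟩
  refine IsOpenEmbedding.of_continuous_injective_isOpenMap
    (hq.comp continuous_subtype_val) ?_ ?_
  · rintro ⟨a, ha⟩ ⟨b, hb⟩ hab
    have hab' : q a = q b := hab
    refine Subtype.ext (hinj a b (e.injOn ha hb ?_) hab')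
    rw [hcomm, hcomm, hab']
  · intro O hO
    obtain ⟨O', hO', rfl⟩ := isOpen_induced_iff.mp hO
    obtain ⟨W, hW, rfl⟩ := hind.isOpen_iff.mp hO'
    rw [isOpen_iff_mem_nhds]
    rintro _ ⟨⟨a, ha⟩, haW, rfl⟩
    have haW' : (p a, q a) ∈ W := haW
    obtain ⟨U, V, hU, hV, haU, haV, hUV⟩ := isOpen_prod_iff.mp hW _ _ haW'
    have hUe : IsOpen (e '' (e.source ∩ U)) :=
      e.isOpen_image_of_subset_source (e.open_source.inter hU) Set.inter_subset_left
    have hmem : V ∩ g ⁻¹' (e '' (e.source ∩ U)) ∈ 𝓝 (q a) :=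
      (hV.inter (hUe.preimage hg)).mem_nhds ⟨haV, ⟨p a, ⟨ha, haU⟩, hcomm a⟩⟩
    refine Filter.mem_of_superset hmem ?_
    rintro y ⟨hyV, x, ⟨hxe, hxU⟩, hxy⟩
    obtain ⟨c, rfl, rfl⟩ := hsurj x y hxy
    exact ⟨⟨c, hxe⟩, hUV ⟨hxU, hyV⟩, rfl⟩

end LocalHomeo

section Pushforward

variable {X Y Z : Type*} [TopologicalSpace X] [TopologicalSpace Y] [TopologicalSpace Z]
  [T2Space X] [T2Space Y] [T2Space Z] {A : Type*} [AddCommGroup A] [TopologicalSpace A]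
  [IsTopologicalAddGroup A]

theorem fibre_inter_finite {φ : X → Y} (hφ : IsLocalHomeomorph φ) {K : Set X} (hK : IsCompact K)
    (y : Y) : (φ ⁻¹' {y} ∩ K).Finite := by
  have hc : IsCompact (φ ⁻¹' {y} ∩ K) :=
    hK.inter_left (isClosed_singleton.preimage hφ.continuous)
  refine hc.finite ?_
  have h1 : IsDiscrete (φ ⁻¹' {y}) := by
    rw [isDiscrete_iff_forall_mem_exists_isOpen]
    intro x hx
    obtain ⟨e, he, rfl⟩ := hφ x
    refine ⟨e.source, e.open_source, ?_⟩
    ext z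
    constructor
    · rintro ⟨hz, hz'⟩
      exact e.injOn hz he (hz'.trans hx.symm)
    · rintro rfl
      exact ⟨he, hx⟩
  exact h1.mono Set.inter_subset_left

/-- The function `y ↦ ∑_{φ x = y} f x`. -/
noncomputable def pushFun (φ : X → Y) (f : X → A) (y : Y) : A :=
  ∑ᶠ x : φ ⁻¹' {y}, f x

theorem pushFun_eq_sum {φ : X → Y} {f : X → A} {y : Y} (S : Finset X)
    (h1 : ∀ x ∈ S, φ x = y) (h2 : ∀ x, φ x = y → f x ≠ 0 → x ∈ S) :
    pushFun φ f y = ∑ x ∈ S, f x := by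
  rw [pushFun, finsum_set_coe_eq_finsum_mem]
  refine finsum_mem_eq_sum_of_inter_support_eq f ?_
  ext x
  simp only [Set.mem_inter_iff, Set.mem_preimage, Set.mem_singleton_iff, Function.mem_support,
    Finset.mem_coe]
  exact ⟨fun h => ⟨h2 x h.1 h.2, h.2⟩, fun h => ⟨h1 x h.1, h.2⟩⟩

theorem exists_fibre_finset {φ : X → Y} (hφ : IsLocalHomeomorph φ) (f : C_c(X, A)) (y : Y) :
    ∃ S : Finset X, (∀ x ∈ S, φ x = y) ∧ ∀ x, φ x = y → x ∈ tsupport f → x ∈ S := by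
  have hfin := fibre_inter_finite hφ f.hasCompactSupport.isCompact y
  refine ⟨hfin.toFinset, fun x hx => ?_, fun x hx hx' => ?_⟩
  · exact ((Set.Finite.mem_toFinset _).mp hx).1
  · exact (Set.Finite.mem_toFinset _).mpr ⟨hx, hx'⟩

theorem continuous_pushFun {φ : X → Y} (hφ : IsLocalHomeomorph φ) (f : C_c(X, A)) :
    Continuous (pushFun φ f) := by
  classical
  rw [continuous_iff_continuousAt]
  intro y
  obtain ⟨S, hS1, hS2⟩ := exists_fibre_finset hφ f y
  obtain ⟨U, hU, hdisj⟩ := S.finite_toSet.t2_separation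
  choose e he heφ using hφ
  set W : X → Set X := fun x => (e x).source ∩ U x with hW
  have hWo : ∀ x, IsOpen (W x) := fun x => (e x).open_source.inter (hU x).2
  have hc : IsClosed (φ '' (tsupport f \ ⋃ x ∈ S, W x)) := by
    refine IsCompact.isClosed (IsCompact.image ?_ ?_)
    · exact f.hasCompactSupport.isCompact.diff (isOpen_biUnion fun x _ => hWo x)
    · rw [continuous_iff_continuousAt]
      intro x
      rw [heφ x]
      exact (e x).continuousAt (he x)
  set N : Set Y := (⋂ x ∈ S, e x '' W x) ∩ (φ '' (tsupport f \ ⋃ x ∈ S, W x))ᶜ with hN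
  have hNo : IsOpen N := by
    refine IsOpen.inter ?_ hc.isOpen_compl
    exact isOpen_biInter_finset fun x _ =>
      (e x).isOpen_image_of_subset_source (hWo x) Set.inter_subset_left
  have hyN : y ∈ N := by
    refine ⟨?_, ?_⟩
    · simp only [Set.mem_iInter]
      intro x hx
      exact ⟨x, ⟨he x, (hU x).1⟩, by rw [← heφ x]; exact hS1 x hx⟩
    · rintro ⟨x, ⟨hx, hx'⟩, hxy⟩
      have := hS2 x hxy hx
      exact hx' (Set.mem_biUnion this ⟨he x, (hU x).1⟩)
  have key : ∀ y' ∈ N, pushFun φ f y' = ∑ x ∈ S, f ((e x).symm y') := by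
    intro y' hy'
    have hmem : ∀ x ∈ S, (e x).symm y' ∈ W x ∧ φ ((e x).symm y') = y' := by
      intro x hx
      have := hy'.1
      simp only [Set.mem_iInter] at this
      obtain ⟨z, hz, hzy⟩ := this x hx
      have hz' : (e x).symm y' = z := by rw [← hzy]; exact (e x).left_inv hz.1
      rw [hz']
      exact ⟨hz, by rw [heφ x]; exact hzy⟩
    have hinj : Set.InjOn (fun x => (e x).symm y') (S : Set X) := by
      intro a ha b hb hab
      by_contra hne
      have h := hdisj ha hb hne
      refine (Set.disjoint_left.mp h) (hmem a ha).1.2 ?_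
      have hab' : (e a).symm y' = (e b).symm y' := hab
      rw [hab']
      exact (hmem b hb).1.2
    rw [← Finset.sum_image (f := fun z => f z) hinj]
    refine pushFun_eq_sum _ ?_ ?_
    · intro z hz
      obtain ⟨x, hx, rfl⟩ := Finset.mem_image.mp hz
      exact (hmem x hx).2
    · intro z hz hfz
      have hzs : z ∈ tsupport f := subset_tsupport _ hfz
      have : z ∈ ⋃ x ∈ S, W x := by
        by_contra hcon
        exact hy'.2 ⟨z, ⟨hzs, hcon⟩, hz⟩
      simp only [Set.mem_iUnion] at this
      obtain ⟨x, hx, hzW⟩ := this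
      refine Finset.mem_image.mpr ⟨x, hx, ?_⟩
      have : e x z = y' := by rw [← hz]; exact (congrFun (heφ x) z).symm
      rw [← this]
      exact (e x).left_inv hzW.1
  have hcont : ContinuousAt (fun y' => ∑ x ∈ S, f ((e x).symm y')) y := by
    refine tendsto_finsetSum _ fun x hx => ?_
    have hy : y ∈ (e x).target := by
      have : e x x = y := by rw [← hS1 x hx]; exact (congrFun (heφ x) x).symm
      rw [← this]
      exact (e x).map_source (he x)
    exact (f.continuous.continuousAt (x := (e x).symm y)).comp ((e x).symm.continuousAt hy)
  refine hcont.congr ?_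
  filter_upwards [hNo.mem_nhds hyN] with y' hy'
  exact (key y' hy').symm

theorem hasCompactSupport_pushFun {φ : X → Y} (hφ : IsLocalHomeomorph φ) (f : C_c(X, A)) :
    HasCompactSupport (pushFun φ f) := by
  refine HasCompactSupport.intro (f.hasCompactSupport.isCompact.image hφ.continuous) ?_
  intro y hy
  rw [pushFun_eq_sum (S := ∅) (by simp), Finset.sum_empty]
  intro x hx hfx
  exact absurd ⟨x, subset_tsupport _ hfx, hx⟩ hy

/-- The pushforward `φ_* : C_c(X, A) → C_c(Y, A)`, `(φ_* f)(y) = ∑_{φ x = y} f x`, along a local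
homeomorphism `φ`. -/
noncomputable def pushforward (φ : X → Y) (hφ : IsLocalHomeomorph φ) :
    C_c(X, A) →ₗ[ℤ] C_c(Y, A) :=
  AddMonoidHom.toIntLinearMap
    { toFun := fun f => ⟨⟨pushFun φ f, continuous_pushFun hφ f⟩, hasCompactSupport_pushFun hφ f⟩
      map_zero' := by
        ext y
        change pushFun φ (0 : C_c(X, A)) y = 0
        rw [pushFun_eq_sum (S := ∅) (by simp) (by simp), Finset.sum_empty]
      map_add' := fun f g => by
        classical
        ext y
        change pushFun φ (f + g : C_c(X, A)) y = pushFun φ f y + pushFun φ g y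
        obtain ⟨S, hS1, hS2⟩ := exists_fibre_finset hφ f y
        obtain ⟨T, hT1, hT2⟩ := exists_fibre_finset hφ g y
        have h1 : ∀ x ∈ S ∪ T, φ x = y := fun x hx =>
          (Finset.mem_union.mp hx).elim (hS1 x) (hT1 x)
        have hf : ∀ x, φ x = y → f x ≠ 0 → x ∈ S ∪ T := fun x hx h =>
          Finset.mem_union_left _ (hS2 x hx (subset_tsupport _ h))
        have hg : ∀ x, φ x = y → g x ≠ 0 → x ∈ S ∪ T := fun x hx h =>
          Finset.mem_union_right _ (hT2 x hx (subset_tsupport _ h))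
        rw [pushFun_eq_sum _ h1 hf, pushFun_eq_sum _ h1 hg, pushFun_eq_sum _ h1,
          ← Finset.sum_add_distrib]
        · rfl
        · intro x hx h
          by_cases h0 : f x = 0
          · refine hg x hx fun h' => h ?_
            simp [h0, h']
          · exact hf x hx h0 }

theorem pushforward_apply (φ : X → Y) (hφ : IsLocalHomeomorph φ) (f : C_c(X, A)) (y : Y) :
    pushforward φ hφ f y = ∑ᶠ x : φ ⁻¹' {y}, f x := rfl

theorem pushforward_id (h : IsLocalHomeomorph (id : X → X)) (f : C_c(X, A)) :
    pushforward id h f = f := by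
  ext y
  change pushFun id f y = f y
  rw [pushFun_eq_sum (S := {y}) (by simp) (by rintro x rfl _; simp), Finset.sum_singleton]

theorem pushforward_comp {φ : X → Y} {ψ : Y → Z} (hφ : IsLocalHomeomorph φ)
    (hψ : IsLocalHomeomorph ψ) {χ : X → Z} (hχ : IsLocalHomeomorph χ) (h : χ = ψ ∘ φ)
    (f : C_c(X, A)) : pushforward χ hχ f = pushforward ψ hψ (pushforward φ hφ f) := by
  classical
  subst h
  ext z
  obtain ⟨S, hS1, hS2⟩ := exists_fibre_finset hχ f z
  change pushFun (ψ ∘ φ) f z = pushFun ψ (pushFun φ f) z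
  rw [pushFun_eq_sum S hS1 fun x hx h => hS2 x hx (subset_tsupport _ h)]
  have key : ∀ y, ψ y = z → pushFun φ f y = ∑ x ∈ S with φ x = y, f x := by
    intro y hy
    refine pushFun_eq_sum _ (by simp) fun x hx h => ?_
    exact Finset.mem_filter.mpr
      ⟨hS2 x (by rw [Function.comp_apply, hx, hy]) (subset_tsupport _ h), hx⟩
  rw [pushFun_eq_sum (S.image φ)]
  · rw [← Finset.sum_fiberwise_of_maps_to (t := S.image φ) (g := φ)
      (fun x hx => Finset.mem_image_of_mem φ hx)]
    refine Finset.sum_congr rfl fun y hy => ?_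
    obtain ⟨x, hx, rfl⟩ := Finset.mem_image.mp hy
    exact (key _ (hS1 x hx)).symm
  · intro y hy
    obtain ⟨x, hx, rfl⟩ := Finset.mem_image.mp hy
    exact hS1 x hx
  · intro y hy h
    rw [key y hy] at h
    obtain ⟨x, hx, -⟩ := Finset.exists_ne_zero_of_sum_ne_zero h
    obtain ⟨hx1, hx2⟩ := Finset.mem_filter.mp hx
    exact Finset.mem_image.mpr ⟨x, hx1, hx2⟩

/-- Composition with a continuous homomorphism of coefficient groups. -/
def coeffMap (X : Type*) [TopologicalSpace X] {B : Type*} [AddCommGroup B] [TopologicalSpace B]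
    [IsTopologicalAddGroup B] (α : A →+ B) (hα : Continuous α) : C_c(X, A) →ₗ[ℤ] C_c(X, B) :=
  AddMonoidHom.toIntLinearMap
    { toFun := fun f =>
        ⟨⟨fun x => α (f x), hα.comp f.continuous⟩, f.hasCompactSupport.comp_left (map_zero α)⟩
      map_zero' := by ext x; exact map_zero α
      map_add' := fun f g => by ext x; exact map_add α (f x) (g x) }

theorem coeffMap_pushforward {φ : X → Y} (hφ : IsLocalHomeomorph φ) {B : Type*} [AddCommGroup B]
    [TopologicalSpace B] [IsTopologicalAddGroup B] (α : A →+ B) (hα : Continuous α)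
    (f : C_c(X, A)) :
    coeffMap Y α hα (pushforward φ hφ f) = pushforward φ hφ (coeffMap X α hα f) := by
  ext y
  obtain ⟨S, hS1, hS2⟩ := exists_fibre_finset hφ f y
  change α (pushFun φ f y) = pushFun φ (fun x => α (f x)) y
  rw [pushFun_eq_sum S hS1 fun x hx h => hS2 x hx (subset_tsupport _ h), map_sum,
    pushFun_eq_sum S hS1]
  intro x hx h
  refine hS2 x hx (subset_tsupport _ fun h0 => h ?_)
  rw [h0, map_zero]

end Pushforward

/-- A topological groupoid: a groupoid whose unit space `Obj` and arrow space `Arrow Obj` carry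
topologies for which all structure maps are continuous. An arrow `γ : x ⟶ y` has range
`r γ = x` and source `s γ = y`, so that `γ₁ γ₂` is defined when `s γ₁ = r γ₂` and is the composite
`γ₁ ≫ γ₂`. Since `r` and the unit map are continuous, the unit map is a topological embedding of
`Obj` into the arrow space. -/
structure TopologicalGroupoid : Type (u + 1) where
  Obj : Type u
  [groupoid : Groupoid.{u} Obj]
  [topObj : TopologicalSpace Obj]
  [topArr : TopologicalSpace (Arrow Obj)]
  continuous_range : Continuous fun γ : Arrow Obj => γ.left
  continuous_source : Continuous fun γ : Arrow Obj => γ.right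
  continuous_unit : Continuous fun x : Obj => Arrow.mk (𝟙 x)
  continuous_inv : Continuous fun γ : Arrow Obj => Arrow.mk (Groupoid.inv γ.hom)
  continuous_mul : Continuous fun p : {p : Arrow Obj × Arrow Obj // p.1.right = p.2.left} =>
    Arrow.mk (p.1.1.hom ≫ eqToHom p.2 ≫ p.1.2.hom)

attribute [instance] TopologicalGroupoid.groupoid TopologicalGroupoid.topObj
  TopologicalGroupoid.topArr

/-- An ample groupoid: a topological groupoid that is étale (its source map is a local
homeomorphism), locally compact, Hausdorff and totally disconnected. -/
structure AmpleGroupoid : Type (u + 1) extends TopologicalGroupoid.{u} where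
  etale : IsLocalHomeomorph fun γ : Arrow Obj => γ.right
  locallyCompact : LocallyCompactSpace (Arrow Obj)
  hausdorff : T2Space (Arrow Obj)
  totallyDisconnected : TotallyDisconnectedSpace (Arrow Obj)

attribute [instance] AmpleGroupoid.hausdorff

namespace AmpleGroupoid

variable (G : AmpleGroupoid.{u})

instance : T2Space G.Obj :=
  T2Space.of_injective_continuous (f := fun x : G.Obj => Arrow.mk (𝟙 x))
    (fun _ _ h => congrArg (fun γ : Arrow G.Obj => γ.left) h) G.continuous_unit

theorem isLocalHomeomorph_range : IsLocalHomeomorph fun γ : Arrow G.Obj => γ.left := by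
  have hinv : ∀ γ : Arrow G.Obj, Arrow.mk (Groupoid.inv (Arrow.mk (Groupoid.inv γ.hom)).hom) = γ := by
    intro γ
    simp
  let e : Arrow G.Obj ≃ₜ Arrow G.Obj :=
    { toFun := fun γ => Arrow.mk (Groupoid.inv γ.hom)
      invFun := fun γ => Arrow.mk (Groupoid.inv γ.hom)
      left_inv := hinv
      right_inv := hinv
      continuous_toFun := G.continuous_inv
      continuous_invFun := G.continuous_inv }
  exact G.etale.comp e.isLocalHomeomorph

/-- The space `G_n` of `n`-simplices `x₀ → x₁ → ⋯ → xₙ` of the nerve of `G`. -/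
def Nerve (n : ℕ) : Type u := ComposableArrows G.Obj n

variable {G}

/-- The vertices `(x₀, …, xₙ)` and the composable arrows `(γ₁, …, γₙ)`, where `γᵢ : xᵢ₋₁ ⟶ xᵢ`, of
a simplex of the nerve. -/
def Nerve.coords {n : ℕ} (F : G.Nerve n) : (Fin (n + 1) → G.Obj) × (Fin n → Arrow G.Obj) :=
  (F.obj, fun i => Arrow.mk (F.map (homOfLE i.castSucc_lt_succ.le)))

/-- `G_n` has the topology of a subspace of the product of `n` copies of the arrow space, and `G_0`
that of the unit space. (For `n ≥ 1` the vertices are continuous functions of the arrows.) -/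
instance (n : ℕ) : TopologicalSpace (G.Nerve n) :=
  TopologicalSpace.induced Nerve.coords inferInstance

namespace Nerve

theorem continuous_coords (n : ℕ) : Continuous (coords : G.Nerve n → _) := continuous_induced_dom

theorem coords_injective (n : ℕ) : Function.Injective (coords : G.Nerve n → _) := by
  intro F F' h
  have h1 : ∀ i, F.obj i = F'.obj i := congrFun (congrArg Prod.fst h)
  have h2 := congrFun (congrArg Prod.snd h)
  refine ComposableArrows.ext h1 fun i hi => ?_
  have h3 := h2 ⟨i, hi⟩
  have key : ∀ {a b c d : G.Obj} (f : a ⟶ b) (g : c ⟶ d) (hac : a = c) (hbd : b = d),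
      Arrow.mk f = Arrow.mk g → f = eqToHom hac ≫ g ≫ eqToHom hbd.symm := by
    rintro a b c d f g rfl rfl h
    simpa using Arrow.mk_injective _ _ h
  exact key _ _ (h1 _) (h1 _) h3

instance (n : ℕ) : T2Space (G.Nerve n) :=
  T2Space.of_injective_continuous (coords_injective n) (continuous_coords n)

/-- The `k`-th vertex. -/
def vertex {n : ℕ} (k : Fin (n + 1)) (F : G.Nerve n) : G.Obj := F.obj k

theorem continuous_vertex {n : ℕ} (k : Fin (n + 1)) :
    Continuous (vertex k : G.Nerve n → G.Obj) :=
  (continuous_apply k).comp (continuous_fst.comp (continuous_coords n))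

theorem continuous_arrow {n : ℕ} (i : Fin n) :
    Continuous fun F : G.Nerve n => Arrow.mk (F.map (homOfLE i.castSucc_lt_succ.le)) :=
  (continuous_apply i).comp (continuous_snd.comp (continuous_coords n))

theorem continuous_map_aux {n : ℕ} (i : Fin (n + 1)) (j : ℕ) (hj : j < n + 1) (hij : i ≤ ⟨j, hj⟩) :
    Continuous fun F : G.Nerve n => Arrow.mk (F.map (homOfLE hij)) := by
  induction j with
  | zero =>
    obtain rfl : i = ⟨0, hj⟩ := le_antisymm hij (Fin.mk_le_of_le_val (Nat.zero_le _))
    have : (fun F : G.Nerve n => Arrow.mk (F.map (homOfLE hij))) =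
        fun F => Arrow.mk (𝟙 (vertex ⟨0, hj⟩ F)) := by
      funext F
      exact congrArg Arrow.mk (F.map_id _)
    rw [this]
    exact G.continuous_unit.comp (continuous_vertex _)
  | succ j ih =>
    by_cases h : i = ⟨j + 1, hj⟩
    · subst h
      have : (fun F : G.Nerve n => Arrow.mk (F.map (homOfLE hij))) =
          fun F => Arrow.mk (𝟙 (vertex ⟨j + 1, hj⟩ F)) := by
        funext F
        exact congrArg Arrow.mk (F.map_id _)
      rw [this]
      exact G.continuous_unit.comp (continuous_vertex _)
    · have hj' : j < n + 1 := by omega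
      have hij' : i ≤ ⟨j, hj'⟩ := by
        have h1 : i.val ≤ j + 1 := hij
        have h2 : i.val ≠ j + 1 := fun h' => h (Fin.ext h')
        exact Fin.mk_le_mk.mpr (by omega)
      have hjn : j < n := by omega
      have c1 := ih hj' hij'
      have c2 := continuous_arrow (G := G) (⟨j, hjn⟩ : Fin n)
      have c3 : Continuous fun F : G.Nerve n =>
          (⟨(Arrow.mk (F.map (homOfLE hij')),
            Arrow.mk (F.map (homOfLE (Fin.castSucc_lt_succ (i := ⟨j, hjn⟩)).le))), rfl⟩ :
            {p : Arrow G.Obj × Arrow G.Obj // p.1.right = p.2.left}) :=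
        (c1.prodMk c2).subtype_mk _
      have c4 := G.continuous_mul.comp c3
      refine c4.congr fun F => ?_
      change Arrow.mk (F.map (homOfLE hij') ≫ 𝟙 _ ≫ F.map _) = _
      rw [Category.id_comp, ← F.map_comp]
      rfl

theorem continuous_map {n : ℕ} {i j : Fin (n + 1)} (hij : i ≤ j) :
    Continuous fun F : G.Nerve n => Arrow.mk (F.map (homOfLE hij)) :=
  continuous_map_aux i j.1 j.2 hij

/-- The operation of a monotone map `θ : [m] → [n]` on the nerve: precomposition of functors
`[n] ⥤ G`. For the monotone injection that omits `i` this is the face map `d_i`. -/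
def simplexMap {m n : ℕ} (θ : Fin (m + 1) →o Fin (n + 1)) (F : G.Nerve n) : G.Nerve m :=
  ComposableArrows.whiskerLeft F θ.monotone.functor

theorem continuous_simplexMap {m n : ℕ} (θ : Fin (m + 1) →o Fin (n + 1)) :
    Continuous (simplexMap θ : G.Nerve n → G.Nerve m) := by
  refine continuous_induced_rng.mpr (Continuous.prodMk ?_ ?_)
  · exact continuous_pi fun i => continuous_vertex (θ i)
  · exact continuous_pi fun i => continuous_map (θ.monotone i.castSucc_lt_succ.le)

/-- The face map that drops the vertex `x₀`. -/
def tail {n : ℕ} (F : G.Nerve (n + 1)) : G.Nerve n := ComposableArrows.δ₀ F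

theorem continuous_tail {n : ℕ} : Continuous (tail : G.Nerve (n + 1) → G.Nerve n) := by
  refine continuous_induced_rng.mpr (Continuous.prodMk ?_ ?_)
  · exact continuous_pi fun i => continuous_vertex i.succ
  · exact continuous_pi fun i => continuous_arrow i.succ

/-- The first arrow of a simplex. -/
def head {n : ℕ} (F : G.Nerve (n + 1)) : Arrow G.Obj :=
  Arrow.mk (F.map (homOfLE (Fin.castSucc_lt_succ (i := (0 : Fin (n + 1)))).le))

theorem isInducing_tail_head {n : ℕ} :
    IsInducing fun F : G.Nerve (n + 1) => (tail F, head F) := by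
  refine ⟨le_antisymm ?_ ?_⟩
  · exact continuous_iff_le_induced.mp (continuous_tail.prodMk (continuous_arrow 0))
  · refine le_trans ?_ (le_of_eq rfl)
    have h : Continuous[TopologicalSpace.induced
        (fun F : G.Nerve (n + 1) => (tail F, head F)) inferInstance, inferInstance]
        (coords : G.Nerve (n + 1) → _) := by
      let t : TopologicalSpace (G.Nerve (n + 1)) := TopologicalSpace.induced
        (fun F : G.Nerve (n + 1) => (tail F, head F)) inferInstance
      have hc : Continuous fun F : G.Nerve (n + 1) => (tail F, head F) := continuous_induced_dom
      have ht := continuous_fst.comp hc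
      have hh := continuous_snd.comp hc
      refine Continuous.prodMk ?_ ?_
      · refine continuous_pi fun i => ?_
        refine Fin.cases ?_ (fun i => ?_) i
        · exact G.continuous_range.comp hh
        · exact (continuous_vertex i).comp ht
      · refine continuous_pi fun i => ?_
        refine Fin.cases ?_ (fun i => ?_) i
        · exact hh
        · exact (continuous_arrow i).comp ht
    exact continuous_iff_le_induced.mp h

theorem tail_head_injective {n : ℕ} (F F' : G.Nerve (n + 1)) (h1 : tail F = tail F')
    (h2 : head F = head F') : F = F' := by
  refine coords_injective _ (Prod.ext ?_ ?_)
  · funext i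
    refine Fin.cases ?_ (fun i => ?_) i
    · exact congrArg (fun γ : Arrow G.Obj => γ.left) h2
    · exact congrArg (vertex i) h1
  · funext i
    refine Fin.cases ?_ (fun i => ?_) i
    · exact h2
    · exact congrArg
        (fun F : G.Nerve n => Arrow.mk (F.map (homOfLE i.castSucc_lt_succ.le))) h1

theorem exists_tail_head {n : ℕ} (F : G.Nerve n) (γ : Arrow G.Obj)
    (h : vertex 0 F = γ.right) : ∃ F' : G.Nerve (n + 1), tail F' = F ∧ head F' = γ := by
  obtain ⟨a, b, f, rfl⟩ := γ.mk_surjective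
  change F.obj 0 = b at h
  subst h
  exact ⟨ComposableArrows.precomp F f, rfl, rfl⟩

theorem isLocalHomeomorph_vertex_zero (n : ℕ) :
    IsLocalHomeomorph (vertex 0 : G.Nerve n → G.Obj) := by
  induction n with
  | zero =>
    have hind : IsEmbedding (vertex 0 : G.Nerve 0 → G.Obj) := by
      refine ⟨⟨le_antisymm (continuous_iff_le_induced.mp (continuous_vertex 0)) ?_⟩, ?_⟩
      · have h : Continuous[TopologicalSpace.induced (vertex 0 : G.Nerve 0 → G.Obj)
            inferInstance, inferInstance] (coords : G.Nerve 0 → _) := by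
          let t : TopologicalSpace (G.Nerve 0) :=
            TopologicalSpace.induced (vertex 0 : G.Nerve 0 → G.Obj) inferInstance
          have hc : Continuous (vertex 0 : G.Nerve 0 → G.Obj) := continuous_induced_dom
          refine Continuous.prodMk ?_ ?_
          · refine continuous_pi fun i => ?_
            obtain rfl : i = 0 := Fin.fin_one_eq_zero _
            exact hc
          · exact continuous_pi fun i => i.elim0
        exact continuous_iff_le_induced.mp h
      · exact fun F F' h => ComposableArrows.ext₀ h
    refine (IsOpenEmbedding.mk hind ?_).isLocalHomeomorph
    have : Set.range (vertex 0 : G.Nerve 0 → G.Obj) = Set.univ :=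
      Set.range_eq_univ.mpr fun x => ⟨ComposableArrows.mk₀ x, rfl⟩
    rw [this]
    exact isOpen_univ
  | succ n ih =>
    have hhead : IsLocalHomeomorph (head : G.Nerve (n + 1) → Arrow G.Obj) :=
      isLocalHomeomorph_of_pullback (p := tail) ih G.continuous_source isInducing_tail_head
        tail_head_injective (fun F => rfl) exists_tail_head
    exact G.isLocalHomeomorph_range.comp hhead

theorem isLocalHomeomorph_vertex {n : ℕ} (k : Fin (n + 1)) :
    IsLocalHomeomorph (vertex k : G.Nerve n → G.Obj) := by
  induction n with
  | zero =>
    obtain rfl : k = 0 := Fin.fin_one_eq_zero _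
    exact isLocalHomeomorph_vertex_zero 0
  | succ n ih =>
    refine Fin.cases (isLocalHomeomorph_vertex_zero _) (fun k => ?_) k
    have htail : IsLocalHomeomorph (tail : G.Nerve (n + 1) → G.Nerve n) := by
      refine isLocalHomeomorph_of_pullback (p := head) G.etale (continuous_vertex 0)
        ((Homeomorph.prodComm _ _).isInducing.comp isInducing_tail_head)
        (fun F F' h1 h2 => tail_head_injective F F' h2 h1) (fun F => rfl) ?_
      intro γ F h
      obtain ⟨F', h1, h2⟩ := exists_tail_head F γ h.symm
      exact ⟨F', h2, h1⟩
    exact (ih k).comp htail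

theorem isLocalHomeomorph_simplexMap {m n : ℕ} (θ : Fin (m + 1) →o Fin (n + 1)) :
    IsLocalHomeomorph (simplexMap θ : G.Nerve n → G.Nerve m) :=
  IsLocalHomeomorph.of_comp (g := vertex 0) (isLocalHomeomorph_vertex (θ 0))
    (isLocalHomeomorph_vertex 0) (continuous_simplexMap θ)

end Nerve

/-- An étale homomorphism of ample groupoids: a homomorphism of groupoids which is a local
homeomorphism on the spaces of arrows. -/
structure EtaleHom (G H : AmpleGroupoid.{u}) where
  functor : G.Obj ⥤ H.Obj
  isLocalHomeomorph : IsLocalHomeomorph fun γ : Arrow G.Obj => Arrow.mk (functor.map γ.hom)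

namespace EtaleHom

variable {H : AmpleGroupoid.{u}} (P : EtaleHom G H)

theorem isLocalHomeomorph_obj : IsLocalHomeomorph P.functor.obj := by
  have hu : ∀ K : AmpleGroupoid.{u}, IsLocalHomeomorph fun x : K.Obj => Arrow.mk (𝟙 x) := fun K =>
    IsLocalHomeomorph.of_comp (g := fun γ : Arrow K.Obj => γ.left)
      (Homeomorph.refl K.Obj).isLocalHomeomorph K.isLocalHomeomorph_range K.continuous_unit
  have hc : Continuous P.functor.obj :=
    (H.continuous_range.comp P.isLocalHomeomorph.continuous).comp G.continuous_unit
  refine IsLocalHomeomorph.of_comp (g := fun x : H.Obj => Arrow.mk (𝟙 x)) ?_ (hu H) hc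
  have h : (fun x : H.Obj => Arrow.mk (𝟙 x)) ∘ P.functor.obj =
      (fun γ : Arrow G.Obj => Arrow.mk (P.functor.map γ.hom)) ∘ fun x => Arrow.mk (𝟙 x) :=
    funext fun x => congrArg Arrow.mk (P.functor.map_id x).symm
  rw [h]
  exact P.isLocalHomeomorph.comp (hu G)

/-- The map induced on the nerves. -/
def nerveMap (n : ℕ) (F : G.Nerve n) : H.Nerve n := (F : ComposableArrows G.Obj n) ⋙ P.functor

theorem isLocalHomeomorph_nerveMap (n : ℕ) : IsLocalHomeomorph (P.nerveMap n) := by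
  have hc : Continuous (P.nerveMap n) := by
    refine continuous_induced_rng.mpr (Continuous.prodMk ?_ ?_)
    · exact continuous_pi fun i => P.isLocalHomeomorph_obj.continuous.comp (Nerve.continuous_vertex i)
    · exact continuous_pi fun i => P.isLocalHomeomorph.continuous.comp (Nerve.continuous_arrow i)
  exact IsLocalHomeomorph.of_comp (g := Nerve.vertex 0)
    (P.isLocalHomeomorph_obj.comp (Nerve.isLocalHomeomorph_vertex 0))
    (Nerve.isLocalHomeomorph_vertex 0) hc

end EtaleHom

section Moore

variable (A : Type v) [AddCommGroup A] [TopologicalSpace A] [IsTopologicalAddGroup A]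

variable (G) in
/-- The simplicial abelian group `n ↦ C_c(G_n, A)`, whose structure maps are the pushforwards along
the structure maps of the nerve. -/
noncomputable def chains : SimplicialObject (ModuleCat.{max u v} ℤ) where
  obj Δ := ModuleCat.of ℤ C_c(G.Nerve Δ.unop.len, A)
  map θ := ModuleCat.ofHom
    (pushforward (Nerve.simplexMap θ.unop.toOrderHom)
      (Nerve.isLocalHomeomorph_simplexMap θ.unop.toOrderHom))
  map_id Δ := by
    ext f : 2
    exact pushforward_id (Homeomorph.refl (G.Nerve Δ.unop.len)).isLocalHomeomorph f
  map_comp θ η := by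
    ext f : 2
    exact pushforward_comp (Nerve.isLocalHomeomorph_simplexMap θ.unop.toOrderHom)
      (Nerve.isLocalHomeomorph_simplexMap η.unop.toOrderHom)
      (Nerve.isLocalHomeomorph_simplexMap (θ ≫ η).unop.toOrderHom) rfl f

variable (G) in
/-- The Moore chain complex `C_c(G_•, A)`, with differential
`∂_n = ∑_{i = 0}^{n} (-1)^i (d_i)_*` for `n ≥ 1` and `∂_0 = 0`. -/
noncomputable def mooreComplex : ChainComplex (ModuleCat.{max u v} ℤ) ℕ :=
  (AlgebraicTopology.alternatingFaceMapComplex _).obj (G.chains A)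

variable (G) in
/-- The Moore homology `H_n(G; A)`. -/
noncomputable def homology (n : ℕ) : ModuleCat.{max u v} ℤ := (G.mooreComplex A).homology n

variable (G) in
/-- `H_{n-1}(G; ℤ)`, which is zero for `n = 0`. -/
noncomputable def predHomology : ℕ → ModuleCat.{u} ℤ
  | 0 => ModuleCat.of ℤ PUnit
  | n + 1 => G.homology ℤ n

variable (G) {A} in
/-- The map `H_n(G; A) → H_n(G; B)` induced by a continuous homomorphism `α : A → B`. -/
noncomputable def homologyCoeffMap {B : Type v} [AddCommGroup B] [TopologicalSpace B]
    [IsTopologicalAddGroup B] (α : A →+ B) (hα : Continuous α) (n : ℕ) :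
    G.homology A n ⟶ G.homology B n :=
  HomologicalComplex.homologyMap ((AlgebraicTopology.alternatingFaceMapComplex _).map
    (X := G.chains A) (Y := G.chains B)
    { app := fun Δ => ModuleCat.ofHom (coeffMap (G.Nerve Δ.unop.len) α hα)
      naturality := fun _ _ θ => by
        ext f : 2
        exact coeffMap_pushforward (Nerve.isLocalHomeomorph_simplexMap θ.unop.toOrderHom) α hα f })
    n

variable {H : AmpleGroupoid.{u}}

/-- The map `H_n(G; A) → H_n(H; A)` induced by an étale homomorphism `G → H`, given on chains by
the pushforwards along `G_n → H_n`. -/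
noncomputable def EtaleHom.homologyMap (P : EtaleHom G H) (n : ℕ) :
    G.homology A n ⟶ H.homology A n :=
  HomologicalComplex.homologyMap ((AlgebraicTopology.alternatingFaceMapComplex _).map
    (X := G.chains A) (Y := H.chains A)
    { app := fun Δ => ModuleCat.ofHom
        (pushforward (P.nerveMap Δ.unop.len) (P.isLocalHomeomorph_nerveMap Δ.unop.len))
      naturality := fun _ _ θ => by
        have h := (P.isLocalHomeomorph_nerveMap _).comp
          (Nerve.isLocalHomeomorph_simplexMap (G := G) θ.unop.toOrderHom)
        ext f : 2
        exact (pushforward_comp (Nerve.isLocalHomeomorph_simplexMap θ.unop.toOrderHom)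
          (P.isLocalHomeomorph_nerveMap _) h rfl f).symm.trans
          (pushforward_comp (P.isLocalHomeomorph_nerveMap _)
            (Nerve.isLocalHomeomorph_simplexMap θ.unop.toOrderHom) h rfl f) }) n

/-- The map `H_{n-1}(G; ℤ) → H_{n-1}(H; ℤ)` induced by an étale homomorphism `G → H`. -/
noncomputable def EtaleHom.predHomologyMap (P : EtaleHom G H) :
    (n : ℕ) → (G.predHomology n ⟶ H.predHomology n)
  | 0 => 𝟙 _
  | n + 1 => P.homologyMap ℤ n

end Moore

end AmpleGroupoid

section Tor

open TensorProduct

variable (R : Type) [CommRing R]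

/-- The functor `M ↦ M ⊗_R A` on `R`-modules. -/
noncomputable def tensorFunctor (A : Type v) [AddCommGroup A] [Module R A] :
    ModuleCat.{u} R ⥤ ModuleCat.{max u v} R where
  obj M := ModuleCat.of R (M ⊗[R] A)
  map f := ModuleCat.ofHom (f.hom.rTensor A)
  map_id M := by
    ext : 1
    exact LinearMap.rTensor_id A M
  map_comp f g := by
    ext : 1
    exact LinearMap.rTensor_comp A g.hom f.hom

instance (A : Type v) [AddCommGroup A] [Module R A] : (tensorFunctor.{u, v} R A).Additive where
  map_add {M N f g} := by
    ext : 1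
    exact LinearMap.rTensor_add A f.hom g.hom

variable {R}

/-- The natural transformation `M ⊗_R A → M ⊗_R B` induced by a linear map `α : A → B`. -/
noncomputable def tensorFunctorMap {A B : Type v} [AddCommGroup A] [Module R A] [AddCommGroup B]
    [Module R B] (α : A →ₗ[R] B) : tensorFunctor.{u, v} R A ⟶ tensorFunctor.{u, v} R B where
  app M := ModuleCat.ofHom (α.lTensor M)
  naturality M N f := by
    ext : 1
    exact (LinearMap.lTensor_comp_rTensor _ f.hom α).trans
      (LinearMap.rTensor_comp_lTensor _ f.hom α).symm

variable (R) in
/-- `Tor_1^R(M, A)` as a functor of `M`: the first left derived functor of `M ↦ M ⊗_R A`. -/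
noncomputable def torOne (A : Type v) [AddCommGroup A] [Module R A] :
    ModuleCat.{u} R ⥤ ModuleCat.{max u v} R :=
  (tensorFunctor.{u, v} R A).leftDerived 1

/-- The map `Tor_1^R(M, A) → Tor_1^R(M, B)`, natural in `M`, induced by a linear map
`α : A → B`. -/
noncomputable def torOneMap {A B : Type v} [AddCommGroup A] [Module R A] [AddCommGroup B]
    [Module R B] (α : A →ₗ[R] B) : torOne.{u, v} R A ⟶ torOne.{u, v} R B :=
  NatTrans.leftDerived (tensorFunctorMap.{u, v} α) 1

end Tor

end AmpleUCT

open AmpleUCT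

/-! For a discrete group `A`, a compactly supported continuous function into `A` takes finitely many
values, so it is a finite combination of integer-valued indicators of its level sets. Hence `C_c(X,
ℤ) ⊗ A ≃ C_c(X, A)` (`tensorCoeffEquiv`), compatibly with pushforwards, and the Moore complex with
coefficients in `A` is the integral one tensored with `A`. As `C_c(X, ℤ)` is torsion-free, the
theorem becomes the universal coefficient theorem for a complex `C` of torsion-free modules over a
Dedekind domain.

Let `Z_n` be the cycles of `C`. The quotient `C_n / Z_n` embeds in `C_{n-1}`, so it is torsion-free,
hence flat, and `Z_n ⊗ A → C_n ⊗ A` is injective. This gives injectivity of `κ`, and for `n ≥ 1` it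
identifies the `n`-cycles of `C ⊗ A` with the kernel of `C_n ⊗ A → Z_{n-1} ⊗ A`. The image of `κ`
consists of the classes of cycles coming from `Z_n ⊗ A`. What remains is to identify `ker (C_n ⊗ A →
Z_{n-1} ⊗ A)` modulo the image of `Z_n ⊗ A` with `Tor₁(H_{n-1}, A)`.

This identification (`FlatPresentation.connecting`) works for every presentation `b : L → M` of a
module `H` with `M` flat. `Tor₁` is computed by a projective resolution `P` of `H`; the identity of
`H` lifts to a map from `d : P₁ → P₀` to `b`. Being an isomorphism on cokernels, the lift yields an
exact sequence `0 → range d → P₀ × range b → M → 0`, which stays exact after tensoring because `M`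
is flat (`exists_mayerVietoris`). Its injectivity and its exactness in the middle say that the lift
induces an isomorphism of `ker (d ⊗ A)` and `ker (b ⊗ A)`, each modulo its tensored kernel. Two
lifts of one map differ by a homotopy (`rTensor_sub_mem_tensorKer`), which gives independence of
choices and both naturalities. -/

namespace AmpleUCT

/-! ### Tensored kernels and the comparison of presentations -/

section Algebra

open TensorProduct

variable {R : Type*} [CommRing R]

/-- The factorization of a linear map through a surjective linear map. -/
noncomputable def factorSurjective {M N T : Type*} [AddCommGroup M] [Module R M] [AddCommGroup N]
    [Module R N] [AddCommGroup T] [Module R T] (p : M →ₗ[R] N) (hp : Function.Surjective p)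
    (f : M →ₗ[R] T) (h : LinearMap.ker p ≤ LinearMap.ker f) : N →ₗ[R] T :=
  (LinearMap.ker p).liftQ f h ∘ₗ (p.quotKerEquivOfSurjective hp).symm.toLinearMap

theorem factorSurjective_apply {M N T : Type*} [AddCommGroup M] [Module R M] [AddCommGroup N]
    [Module R N] [AddCommGroup T] [Module R T] (p : M →ₗ[R] N) (hp : Function.Surjective p)
    (f : M →ₗ[R] T) (h : LinearMap.ker p ≤ LinearMap.ker f) (m : M) :
    factorSurjective p hp f h (p m) = f m := by
  have : (p.quotKerEquivOfSurjective hp).symm (p m) = (LinearMap.ker p).mkQ m := by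
    rw [LinearEquiv.symm_apply_eq]
    rfl
  simp [factorSurjective, this]

variable {L M L' M' : Type*} [AddCommGroup L] [Module R L] [AddCommGroup M] [Module R M]
  [AddCommGroup L'] [Module R L'] [AddCommGroup M'] [Module R M']
  (A : Type*) [AddCommGroup A] [Module R A]

/-- The image of `ker b ⊗ A` in `L ⊗ A`. -/
noncomputable def tensorKer (b : L →ₗ[R] M) : Submodule R (L ⊗[R] A) :=
  LinearMap.range ((LinearMap.ker b).subtype.rTensor A)

variable {A}

/-- Right exactness applied to `ker b → L → range b → 0`: the quotient of `L ⊗ A` by `tensorKer A b`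
is `range b ⊗ A`. Questions modulo `tensorKer` thus become questions in `range b ⊗ A`. -/
theorem mem_tensorKer_iff {b : L →ₗ[R] M} {x : L ⊗[R] A} :
    x ∈ tensorKer A b ↔ b.rangeRestrict.rTensor A x = 0 := by
  have h : Function.Exact (LinearMap.ker b).subtype b.rangeRestrict := by
    rw [LinearMap.exact_iff, LinearMap.ker_rangeRestrict, Submodule.range_subtype]
  exact (rTensor_exact A h b.surjective_rangeRestrict x).symm

theorem rTensor_eq_subtype_rangeRestrict (b : L →ₗ[R] M) (x : L ⊗[R] A) :
    b.rTensor A x = (LinearMap.range b).subtype.rTensor A (b.rangeRestrict.rTensor A x) := by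
  rw [← LinearMap.rTensor_comp_apply]
  rfl

theorem tensorKer_le (b : L →ₗ[R] M) : tensorKer A b ≤ LinearMap.ker (b.rTensor A) := by
  intro x hx
  rw [LinearMap.mem_ker, rTensor_eq_subtype_rangeRestrict, mem_tensorKer_iff.mp hx, map_zero]

theorem rTensor_mem_tensorKer {b : L →ₗ[R] M} {T : Type*} [AddCommGroup T] [Module R T]
    (f : T →ₗ[R] L) (h : ∀ t, b (f t) = 0) (x : T ⊗[R] A) : f.rTensor A x ∈ tensorKer A b := by
  refine ⟨(f.codRestrict (LinearMap.ker b) h).rTensor A x, ?_⟩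
  rw [← LinearMap.rTensor_comp_apply]
  rfl

theorem rTensor_map_tensorKer {b : L →ₗ[R] M} {b' : L' →ₗ[R] M'} (f : L →ₗ[R] L')
    (h : ∀ t, b t = 0 → b' (f t) = 0) {x : L ⊗[R] A} (hx : x ∈ tensorKer A b) :
    f.rTensor A x ∈ tensorKer A b' := by
  obtain ⟨z, rfl⟩ := hx
  rw [← LinearMap.rTensor_comp_apply]
  exact rTensor_mem_tensorKer (f ∘ₗ (LinearMap.ker b).subtype) (fun t => h _ t.2) z

theorem lTensor_map_tensorKer {B : Type*} [AddCommGroup B] [Module R B] {b : L →ₗ[R] M}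
    (α : A →ₗ[R] B) {x : L ⊗[R] A} (hx : x ∈ tensorKer A b) : α.lTensor L x ∈ tensorKer B b := by
  obtain ⟨z, rfl⟩ := hx
  refine ⟨α.lTensor _ z, ?_⟩
  rw [← LinearMap.comp_apply, ← LinearMap.comp_apply, LinearMap.lTensor_comp_rTensor,
    LinearMap.rTensor_comp_lTensor]

theorem rTensor_lTensor_apply {B : Type*} [AddCommGroup B] [Module R B] (f : L →ₗ[R] M)
    (α : A →ₗ[R] B) (x : L ⊗[R] A) :
    f.rTensor B (α.lTensor L x) = α.lTensor M (f.rTensor A x) := by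
  rw [← LinearMap.comp_apply, ← LinearMap.comp_apply, LinearMap.lTensor_comp_rTensor,
    LinearMap.rTensor_comp_lTensor]

/-- The obstruction to injectivity is `Tor₁(Q, A)`, which vanishes for flat `Q`. -/
theorem rTensor_injective_of_exact_of_flat {N Q : Type*} [AddCommGroup N] [Module R N]
    [AddCommGroup Q] [Module R Q] [Module.Flat R Q] {g : N →ₗ[R] M} {f : M →ₗ[R] Q}
    (hg : Function.Injective g) (hf : Function.Surjective f) (h : Function.Exact g f) :
    Function.Injective (g.rTensor A) :=
  (LinearMap.lTensor_inj_iff_rTensor_inj _ _).mp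
    (LinearMap.lTensor_injective_of_exact_of_flat f hf g hg h A)

theorem prod_tensor_eq_zero {x : (L × M) ⊗[R] A}
    (h1 : (LinearMap.fst R L M).rTensor A x = 0) (h2 : (LinearMap.snd R L M).rTensor A x = 0) :
    x = 0 := by
  have h : LinearMap.inl R L M ∘ₗ LinearMap.fst R L M +
      LinearMap.inr R L M ∘ₗ LinearMap.snd R L M = LinearMap.id := by
    ext <;> simp
  have := congrArg (fun f => LinearMap.rTensor A f x) h
  simpa [LinearMap.rTensor_add, LinearMap.rTensor_comp_apply, h1, h2] using this.symm

section Comparison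

variable {b : L →ₗ[R] M} {b' : L' →ₗ[R] M'} {f₁ : L →ₗ[R] L'} {f₀ : M →ₗ[R] M'}
  [Module.Flat R M']

/-- A map of presentations that is an isomorphism on cokernels gives a short exact sequence
`0 → range b → M × range b' → M' → 0`, which stays exact after tensoring when `M'` is flat. -/
theorem exists_mayerVietoris (hcomm : ∀ x, b' (f₁ x) = f₀ (b x))
    (hinj : ∀ m, f₀ m ∈ LinearMap.range b' → m ∈ LinearMap.range b)
    (hsurj : ∀ m', ∃ m, m' - f₀ m ∈ LinearMap.range b') :
    ∃ (i : LinearMap.range b →ₗ[R] M × LinearMap.range b')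
      (p : M × LinearMap.range b' →ₗ[R] M'),
      (∀ z, (i z).1 = z) ∧ (∀ x, (i (b.rangeRestrict x)).2 = b'.rangeRestrict (f₁ x)) ∧
      (∀ z, p z = f₀ z.1 - z.2) ∧ Function.Injective (i.rTensor A) ∧
      Function.Exact (i.rTensor A) (p.rTensor A) := by
  have hβ : ∀ z : LinearMap.range b, f₀ z ∈ LinearMap.range b' := by
    rintro ⟨_, x, rfl⟩
    exact ⟨f₁ x, hcomm x⟩
  let i : LinearMap.range b →ₗ[R] M × LinearMap.range b' :=
    (LinearMap.range b).subtype.prod ((f₀ ∘ₗ (LinearMap.range b).subtype).codRestrict _ hβ)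
  let p : M × LinearMap.range b' →ₗ[R] M' :=
    f₀ ∘ₗ LinearMap.fst R _ _ - (LinearMap.range b').subtype ∘ₗ LinearMap.snd R _ _
  have hi : Function.Injective i := fun z z' h => Subtype.ext (congrArg Prod.fst h)
  have hp : Function.Surjective p := by
    intro m'
    obtain ⟨m, hm⟩ := hsurj m'
    -- The minus sign cancels the one in `p (m, w) = f₀ m - w`.
    refine ⟨(m, -⟨_, hm⟩), ?_⟩
    simp [p]
  have hex : Function.Exact i p := by
    rintro ⟨m, w⟩
    constructor
    · intro h
      have h' : f₀ m = w := sub_eq_zero.mp h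
      refine ⟨⟨m, hinj m (h' ▸ w.2)⟩, Prod.ext rfl (Subtype.ext h')⟩
    · rintro ⟨z, hz⟩
      rw [← hz]
      exact sub_self _
  exact ⟨i, p, fun _ => rfl, fun x => Subtype.ext (hcomm x).symm, fun _ => rfl,
    rTensor_injective_of_exact_of_flat hi hp hex, rTensor_exact A hex hp⟩

/-- Injectivity half of the comparison. The class of `x` in `range b ⊗ A` has components `b x` and
the class of `f₁ x` in `(M × range b') ⊗ A`; both vanish, and `i ⊗ A` is injective. -/
theorem mem_tensorKer_of_map_mem (hcomm : ∀ x, b' (f₁ x) = f₀ (b x))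
    (hinj : ∀ m, f₀ m ∈ LinearMap.range b' → m ∈ LinearMap.range b)
    (hsurj : ∀ m', ∃ m, m' - f₀ m ∈ LinearMap.range b') {x : L ⊗[R] A}
    (hx : b.rTensor A x = 0) (hfx : f₁.rTensor A x ∈ tensorKer A b') : x ∈ tensorKer A b := by
  obtain ⟨i, p, h1, h2, -, hi, -⟩ := exists_mayerVietoris (A := A) hcomm hinj hsurj
  rw [mem_tensorKer_iff] at hfx ⊢
  refine hi ?_
  rw [map_zero]
  refine prod_tensor_eq_zero ?_ ?_
  · rw [← LinearMap.rTensor_comp_apply, ← LinearMap.rTensor_comp_apply, ← hx]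
    congr 2
    ext y
    exact h1 _
  · rw [← LinearMap.rTensor_comp_apply, ← LinearMap.rTensor_comp_apply, ← hfx,
      ← LinearMap.rTensor_comp_apply]
    congr 2
    ext y
    exact congrArg Subtype.val (h2 y)

/-- Surjectivity half of the comparison, from exactness in the middle of the tensored sequence. -/
theorem exists_sub_mem_tensorKer (hcomm : ∀ x, b' (f₁ x) = f₀ (b x))
    (hinj : ∀ m, f₀ m ∈ LinearMap.range b' → m ∈ LinearMap.range b)
    (hsurj : ∀ m', ∃ m, m' - f₀ m ∈ LinearMap.range b') {x' : L' ⊗[R] A}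
    (hx' : b'.rTensor A x' = 0) :
    ∃ x, b.rTensor A x = 0 ∧ x' - f₁.rTensor A x ∈ tensorKer A b' := by
  obtain ⟨i, p, h1, h2, h3, -, hex⟩ := exists_mayerVietoris (A := A) hcomm hinj hsurj
  set w := b'.rangeRestrict.rTensor A x' with hw
  -- The element `(0, w)` is killed by `p ⊗ A` because `w` dies in `M' ⊗ A`. Its preimage `z`
  -- vanishes in `M ⊗ A` and maps to `w`, so any lift of `z` to `L ⊗ A` serves as `x`.
  obtain ⟨z, hz⟩ := (hex ((LinearMap.inr R M _).rTensor A w)).mp (by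
    have : p ∘ₗ LinearMap.inr R M (LinearMap.range b') = -(LinearMap.range b').subtype := by
      ext y
      simp [h3]
    rw [← LinearMap.rTensor_comp_apply, this, LinearMap.rTensor_neg, LinearMap.neg_apply, hw,
      ← rTensor_eq_subtype_rangeRestrict, hx', neg_zero])
  obtain ⟨x, rfl⟩ := LinearMap.rTensor_surjective A b.surjective_rangeRestrict z
  refine ⟨x, ?_, ?_⟩
  · have := congrArg ((LinearMap.fst R M _).rTensor A) hz
    rw [← LinearMap.rTensor_comp_apply, ← LinearMap.rTensor_comp_apply,
      ← LinearMap.rTensor_comp_apply, LinearMap.fst_comp_inr, LinearMap.rTensor_zero] at this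
    refine Eq.trans ?_ this
    congr 2
    ext y
    exact (h1 (b.rangeRestrict y)).symm
  · have := congrArg ((LinearMap.snd R M _).rTensor A) hz
    rw [← LinearMap.rTensor_comp_apply, ← LinearMap.rTensor_comp_apply,
      ← LinearMap.rTensor_comp_apply, LinearMap.snd_comp_inr, LinearMap.rTensor_id] at this
    rw [mem_tensorKer_iff, map_sub, sub_eq_zero, ← LinearMap.rTensor_comp_apply, ← hw]
    refine this.symm.trans ?_
    congr 2
    ext y
    exact congrArg Subtype.val (h2 y)

end Comparison

/-- Two maps from a complex of projectives to a presentation that agree on cokernels induce the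
same map on tensored kernels, up to the image of the tensored kernel. -/
theorem rTensor_sub_mem_tensorKer [Module.Projective R M] {b : L →ₗ[R] M} {b' : L' →ₗ[R] M'}
    {f₁ g₁ : L →ₗ[R] L'} {f₀ g₀ : M →ₗ[R] M'} (hf : ∀ x, b' (f₁ x) = f₀ (b x))
    (hg : ∀ x, b' (g₁ x) = g₀ (b x)) (h : ∀ m, f₀ m - g₀ m ∈ LinearMap.range b')
    {y : L ⊗[R] A} (hy : b.rTensor A y = 0) :
    f₁.rTensor A y - g₁.rTensor A y ∈ tensorKer A b' := by
  -- The homotopy: `s : M → L'` with `b' ∘ s = f₀ - g₀`. Then `f₁ - g₁ - s ∘ b` takes values in `ker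
  -- b'`, and the term `s ∘ b` disappears on `ker (b ⊗ A)`.
  obtain ⟨s, hs⟩ := Module.projective_lifting_property b'.rangeRestrict
    ((f₀ - g₀).codRestrict (LinearMap.range b') h) b'.surjective_rangeRestrict
  have hs' : ∀ m, b' (s m) = f₀ m - g₀ m := fun m =>
    congrArg Subtype.val (LinearMap.congr_fun hs m)
  have h0 : (f₁ - g₁ - s ∘ₗ b).rTensor A y = f₁.rTensor A y - g₁.rTensor A y := by
    rw [LinearMap.rTensor_sub, LinearMap.rTensor_sub, LinearMap.sub_apply, LinearMap.sub_apply,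
      LinearMap.rTensor_comp_apply, hy, map_zero, sub_zero]
  rw [← h0]
  exact rTensor_mem_tensorKer _ (fun t => by simp [hf, hg, hs']) y

end Algebra

/-! ### Homology classes of cycles, in terms of elements -/

section HomologyClass

variable {R : Type*} [Ring R]

theorem iCycles_injective (K : ChainComplex (ModuleCat.{v} R) ℕ) (i : ℕ) :
    Function.Injective (K.iCycles i).hom :=
  (ModuleCat.mono_iff_injective _).mp inferInstance

/-- The identification of the kernel of the differential with the cycles. -/
noncomputable def kerToCycles (K : ChainComplex (ModuleCat.{v} R) ℕ) (i j : ℕ)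
    (h : (ComplexShape.down ℕ).next i = j) : LinearMap.ker (K.d i j).hom →ₗ[R] K.cycles i :=
  (K.liftCycles (ModuleCat.ofHom (LinearMap.ker (K.d i j).hom).subtype) j h
    (by ext x; exact x.2)).hom

/-- The homology class of a cycle. -/
noncomputable def homologyClass (K : ChainComplex (ModuleCat.{v} R) ℕ) (i j : ℕ)
    (h : (ComplexShape.down ℕ).next i = j) : LinearMap.ker (K.d i j).hom →ₗ[R] K.homology i :=
  (K.homologyπ i).hom ∘ₗ kerToCycles K i j h

variable {K K' : ChainComplex (ModuleCat.{v} R) ℕ} {i j : ℕ}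
  (h : (ComplexShape.down ℕ).next i = j)

theorem iCycles_kerToCycles (x : LinearMap.ker (K.d i j).hom) :
    (K.iCycles i).hom (kerToCycles K i j h x) = x :=
  ConcreteCategory.congr_hom (K.liftCycles_i
    (ModuleCat.ofHom (LinearMap.ker (K.d i j).hom).subtype) j h (by ext x; exact x.2)) x

theorem homologyClass_surjective : Function.Surjective (homologyClass K i j h) := by
  intro x
  obtain ⟨z, rfl⟩ := (ModuleCat.epi_iff_surjective (K.homologyπ i)).mp inferInstance x
  have hz : (K.d i j).hom ((K.iCycles i).hom z) = 0 :=
    ConcreteCategory.congr_hom (K.iCycles_d i j) z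
  exact ⟨⟨_, hz⟩, congrArg (K.homologyπ i).hom
    (iCycles_injective K i (iCycles_kerToCycles h ⟨_, hz⟩))⟩

theorem homologyClass_eq_zero_iff {k : ℕ} (hk : (ComplexShape.down ℕ).prev i = k)
    (x : LinearMap.ker (K.d i j).hom) :
    homologyClass K i j h x = 0 ↔ ∃ w, (K.d k i).hom w = x := by
  have hex : (ShortComplex.mk (K.toCycles k i) (K.homologyπ i)
      (K.toCycles_comp_homologyπ k i)).Exact :=
    ShortComplex.exact_of_g_is_cokernel _ (K.homologyIsCokernel k i hk)
  rw [ShortComplex.ShortExact.moduleCat_exact_iff_function_exact] at hex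
  have hi : ∀ w, (K.iCycles i).hom ((K.toCycles k i).hom w) = (K.d k i).hom w :=
    fun w => ConcreteCategory.congr_hom (K.toCycles_i k i) w
  refine (hex (kerToCycles K i j h x)).trans ⟨?_, ?_⟩
  · rintro ⟨w, hw⟩
    refine ⟨w, ?_⟩
    rw [← iCycles_kerToCycles h x, ← hw, ← hi]
  · rintro ⟨w, hw⟩
    refine ⟨w, iCycles_injective K i ?_⟩
    rw [iCycles_kerToCycles h x, ← hw, ← hi]

theorem homologyMap_homologyClass (f : K ⟶ K') (x : LinearMap.ker (K.d i j).hom)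
    (hx : (f.f i).hom x ∈ LinearMap.ker (K'.d i j).hom) :
    (HomologicalComplex.homologyMap f i).hom (homologyClass K i j h x) =
      homologyClass K' i j h ⟨(f.f i).hom x, hx⟩ := by
  refine (ConcreteCategory.congr_hom (HomologicalComplex.homologyπ_naturality f i)
    (kerToCycles K i j h x)).trans (congrArg (K'.homologyπ i).hom (iCycles_injective K' i ?_))
  refine (ConcreteCategory.congr_hom (HomologicalComplex.cyclesMap_i f i)
    (kerToCycles K i j h x)).trans ?_
  rw [iCycles_kerToCycles]
  exact congrArg (f.f i).hom (iCycles_kerToCycles h x)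

end HomologyClass

/-! ### `Tor₁` computed from a presentation with flat middle term -/

section Connecting

open TensorProduct

variable {R : Type} [CommRing R]

/-- A presentation `L → M → H → 0` of `H` with `M` flat. -/
structure FlatPresentation (L H : Type u) [AddCommGroup L] [Module R L] [AddCommGroup H]
    [Module R H] where
  M : Type u
  [addCommGroup : AddCommGroup M]
  [module : Module R M]
  [flat : Module.Flat R M]
  b : L →ₗ[R] M
  p : M →ₗ[R] H
  exact : Function.Exact b p
  surjective : Function.Surjective p

attribute [instance] FlatPresentation.addCommGroup FlatPresentation.module FlatPresentation.flat

namespace Resolution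

variable {X Y : ModuleCat.{u} R} (P : ProjectiveResolution X) (P' : ProjectiveResolution Y)

/-- The differential `P₁ → P₀`. -/
abbrev d : P.complex.X 1 →ₗ[R] P.complex.X 0 := (P.complex.d 1 0).hom

/-- The augmentation `P₀ → X`. -/
noncomputable abbrev aug : P.complex.X 0 →ₗ[R] X := (P.π.f 0).hom

instance (n : ℕ) : Module.Projective R (P.complex.X n) :=
  (IsProjective.iff_projective _).mpr (P.projective n)

theorem aug_surjective : Function.Surjective (aug P) :=
  (ModuleCat.epi_iff_surjective (P.π.f 0)).mp inferInstance

theorem exact_d_aug : Function.Exact (d P) (aug P) :=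
  (ShortComplex.ShortExact.moduleCat_exact_iff_function_exact _).mp P.exact₀

theorem exact_d_d : Function.Exact (P.complex.d 2 1).hom (d P) :=
  (ShortComplex.ShortExact.moduleCat_exact_iff_function_exact _).mp (P.exact_succ 0)

variable (A : Type v) [AddCommGroup A] [Module R A]

/-- The class in `Tor₁` of an element of the kernel of `P₁ ⊗ A → P₀ ⊗ A`. -/
noncomputable def torClass :
    LinearMap.ker ((d P).rTensor A) →ₗ[R] (torOne.{u, v} R A).obj X :=
  (P.isoLeftDerivedObj (tensorFunctor.{u, v} R A) 1).inv.hom ∘ₗ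
    homologyClass (((tensorFunctor.{u, v} R A).mapHomologicalComplex _).obj P.complex) 1 0 (by simp)

variable {A} in
theorem torClass_eq (y : LinearMap.ker ((d P).rTensor A)) :
    torClass P A y = (P.isoLeftDerivedObj (tensorFunctor.{u, v} R A) 1).inv.hom
      (homologyClass (((tensorFunctor.{u, v} R A).mapHomologicalComplex _).obj P.complex) 1 0
        (by simp) y) := rfl

theorem torClass_surjective : Function.Surjective (torClass P A) :=
  (P.isoLeftDerivedObj (tensorFunctor.{u, v} R A) 1).symm.toLinearEquiv.surjective.comp
    (homologyClass_surjective _)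

variable {A}

/-- Exactness at `P₁` makes the image of `P₂ ⊗ A` in `P₁ ⊗ A` equal to that of `ker d ⊗ A`. So
`Tor₁` is described by `d : P₁ → P₀` alone, in the form used for presentations. -/
theorem torClass_eq_zero_iff (y : LinearMap.ker ((d P).rTensor A)) :
    torClass P A y = 0 ↔ (y : P.complex.X 1 ⊗[R] A) ∈ tensorKer A (d P) := by
  have h1 : torClass P A y = 0 ↔
      homologyClass (((tensorFunctor.{u, v} R A).mapHomologicalComplex _).obj P.complex) 1 0
        (by simp) y = 0 :=
    (P.isoLeftDerivedObj (tensorFunctor.{u, v} R A) 1).symm.toLinearEquiv.map_eq_zero_iff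
  refine (h1.trans (homologyClass_eq_zero_iff _ (k := 2) (by simp) _)).trans ⟨?_, ?_⟩
  · rintro ⟨w, hw⟩
    have hw' : (P.complex.d 2 1).hom.rTensor A w = y := hw
    rw [← hw']
    exact rTensor_mem_tensorKer _ (fun t => (exact_d_d P _).mpr ⟨t, rfl⟩) w
  · rintro hy
    have hy' := mem_tensorKer_iff.mp hy
    have hex : Function.Exact (P.complex.d 2 1).hom (d P).rangeRestrict := by
      rw [LinearMap.exact_iff, LinearMap.ker_rangeRestrict, ← LinearMap.exact_iff]
      exact exact_d_d P
    exact (rTensor_exact A hex (d P).surjective_rangeRestrict _).mp hy'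

theorem lTensor_mem_ker {B : Type v} [AddCommGroup B] [Module R B] {L M : Type*} [AddCommGroup L]
    [Module R L] [AddCommGroup M] [Module R M] {b : L →ₗ[R] M} (α : A →ₗ[R] B) {x : L ⊗[R] A}
    (hx : x ∈ LinearMap.ker (b.rTensor A)) : α.lTensor L x ∈ LinearMap.ker (b.rTensor B) := by
  rw [LinearMap.mem_ker, rTensor_lTensor_apply, LinearMap.mem_ker.mp hx, map_zero]

/-- On any projective resolution the derived transformation is induced by `id ⊗ α` on chains. -/
theorem torOneMap_torClass {B : Type v} [AddCommGroup B] [Module R B] (α : A →ₗ[R] B)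
    (y : LinearMap.ker ((d P).rTensor A)) :
    ((torOneMap.{u, v} α).app X).hom (torClass P A y) =
      torClass P B ⟨α.lTensor _ y, lTensor_mem_ker α y.2⟩ := by
  have h := P.leftDerived_app_eq (tensorFunctorMap.{u, v} α) 1
  rw [torClass_eq]
  have h' := ConcreteCategory.congr_hom h
    ((P.isoLeftDerivedObj (tensorFunctor.{u, v} R A) 1).inv.hom
      (homologyClass (((tensorFunctor.{u, v} R A).mapHomologicalComplex _).obj P.complex) 1 0
        (by simp) y))
  refine h'.trans (congrArg (P.isoLeftDerivedObj (tensorFunctor.{u, v} R B) 1).inv.hom ?_)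
  refine (congrArg _ (ConcreteCategory.congr_hom
    (P.isoLeftDerivedObj (tensorFunctor.{u, v} R A) 1).inv_hom_id _)).trans ?_
  exact homologyMap_homologyClass _ ((NatTrans.mapHomologicalComplex
    (tensorFunctorMap.{u, v} α) _).app P.complex) y (lTensor_mem_ker α y.2)

variable {P P'} in
theorem torOne_map_torClass (g : X ⟶ Y) (φ : P.complex ⟶ P'.complex)
    (hφ : φ.f 0 ≫ P'.π.f 0 = P.π.f 0 ≫ g) (y : LinearMap.ker ((d P).rTensor A))
    (hy : (φ.f 1).hom.rTensor A y ∈ LinearMap.ker ((d P').rTensor A)) :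
    ((torOne.{u, v} R A).map g).hom (torClass P A y) =
      torClass P' A ⟨(φ.f 1).hom.rTensor A y, hy⟩ := by
  have h := P.isoLeftDerivedObj_inv_naturality g P' φ hφ (tensorFunctor.{u, v} R A) 1
  refine (ConcreteCategory.congr_hom h _).trans
    (congrArg (P'.isoLeftDerivedObj (tensorFunctor.{u, v} R A) 1).inv.hom ?_)
  exact homologyMap_homologyClass _
    (((tensorFunctor.{u, v} R A).mapHomologicalComplex _).map φ) y hy

end Resolution

namespace FlatPresentation

open Resolution

variable {L H : Type u} [AddCommGroup L] [Module R L] [AddCommGroup H] [Module R H]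
  (Q : FlatPresentation (R := R) L H)

/-- A map from the beginning of a projective resolution of `X` to a presentation of `H` over a map
`X → H`. -/
structure Lift {X : ModuleCat.{u} R} (P : ProjectiveResolution X) (g : X →ₗ[R] H) where
  f₁ : P.complex.X 1 →ₗ[R] L
  f₀ : P.complex.X 0 →ₗ[R] Q.M
  comm : ∀ x, Q.b (f₁ x) = f₀ (d P x)
  aug : ∀ x, Q.p (f₀ x) = g (aug P x)

variable {Q}

/-- Projectivity of `P₀` lifts `g` through `p`; the composite `f₀ ∘ d` then lands in `ker p = range
b`, and projectivity of `P₁` lifts it through `b`. -/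
theorem nonempty_lift {X : ModuleCat.{u} R} (P : ProjectiveResolution X) (g : X →ₗ[R] H) :
    Nonempty (Q.Lift P g) := by
  obtain ⟨f₀, hf₀⟩ := Module.projective_lifting_property Q.p (g ∘ₗ aug P) Q.surjective
  have haug : ∀ x, Q.p (f₀ x) = g (aug P x) := LinearMap.congr_fun hf₀
  have hr : ∀ x, f₀ (d P x) ∈ LinearMap.range Q.b := fun x => (Q.exact _).mp (by
    rw [haug, (exact_d_aug P _).mpr ⟨x, rfl⟩, map_zero])
  obtain ⟨f₁, hf₁⟩ := Module.projective_lifting_property Q.b.rangeRestrict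
    ((f₀ ∘ₗ d P).codRestrict (LinearMap.range Q.b) hr) Q.b.surjective_rangeRestrict
  exact ⟨⟨f₁, f₀, fun x => congrArg Subtype.val (LinearMap.congr_fun hf₁ x), haug⟩⟩

namespace Lift

variable {X : ModuleCat.{u} R} {P : ProjectiveResolution X} {g : X →ₗ[R] H} (F F' : Q.Lift P g)
  {A : Type v} [AddCommGroup A] [Module R A]

include F in
theorem rTensor_mem_ker {y : P.complex.X 1 ⊗[R] A} (hy : y ∈ LinearMap.ker ((d P).rTensor A)) :
    F.f₁.rTensor A y ∈ LinearMap.ker (Q.b.rTensor A) := by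
  have h : Q.b ∘ₗ F.f₁ = F.f₀ ∘ₗ d P := LinearMap.ext F.comm
  rw [LinearMap.mem_ker, ← LinearMap.rTensor_comp_apply, h, LinearMap.rTensor_comp_apply,
    LinearMap.mem_ker.mp hy, map_zero]

theorem sub_mem_tensorKer {y : P.complex.X 1 ⊗[R] A} (hy : y ∈ LinearMap.ker ((d P).rTensor A)) :
    F.f₁.rTensor A y - F'.f₁.rTensor A y ∈ tensorKer A Q.b :=
  rTensor_sub_mem_tensorKer F.comm F'.comm
    (fun m => (Q.exact _).mp (by rw [map_sub, F.aug, F'.aug, sub_self])) hy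

/-- The map induced on the cokernels of `d P` and `Q.b` is `g`. This lemma and the next turn
injectivity and surjectivity of `g` into the hypotheses of the comparison. -/
theorem mem_range_of_mem_range (hg : Function.Injective g) (m : P.complex.X 0)
    (h : F.f₀ m ∈ LinearMap.range Q.b) : m ∈ LinearMap.range (d P) := by
  refine (exact_d_aug P m).mp (hg ?_)
  rw [← F.aug, (Q.exact _).mpr h, map_zero]

theorem exists_sub_mem_range (hg : Function.Surjective g) (m' : Q.M) :
    ∃ m, m' - F.f₀ m ∈ LinearMap.range Q.b := by
  obtain ⟨x, hx⟩ := hg (Q.p m')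
  obtain ⟨m, rfl⟩ := aug_surjective P x
  exact ⟨m, (Q.exact _).mp (by rw [map_sub, F.aug, hx, sub_self])⟩

end Lift

variable (Q)

/-- The chosen map from the chosen projective resolution of `H`. -/
noncomputable def lift : Q.Lift (projectiveResolution (ModuleCat.of R H)) LinearMap.id :=
  (nonempty_lift _ _).some

variable (A : Type v) [AddCommGroup A] [Module R A]

/-- The sum of the map on kernels induced by the chosen lift, and of the inclusion of
`tensorKer`. -/
noncomputable def sumMap :
    LinearMap.ker ((d (projectiveResolution (ModuleCat.of R H))).rTensor A) × tensorKer A Q.b →ₗ[R]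
      LinearMap.ker (Q.b.rTensor A) :=
  ((Q.lift.f₁.rTensor A).restrict fun _ hy => Q.lift.rTensor_mem_ker hy).coprod
    (Submodule.inclusion (tensorKer_le Q.b))

variable {A} in
theorem sumMap_coe (z : LinearMap.ker ((d (projectiveResolution (ModuleCat.of R H))).rTensor A) ×
    tensorKer A Q.b) : (Q.sumMap A z : L ⊗[R] A) = Q.lift.f₁.rTensor A z.1 + z.2 := rfl

theorem sumMap_surjective : Function.Surjective (Q.sumMap A) := by
  rintro ⟨x, hx⟩
  obtain ⟨y, hy, hxy⟩ := exists_sub_mem_tensorKer Q.lift.comm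
    (Q.lift.mem_range_of_mem_range Function.injective_id)
    (Q.lift.exists_sub_mem_range Function.surjective_id) hx
  exact ⟨(⟨y, hy⟩, ⟨_, hxy⟩), Subtype.ext (by simp [sumMap_coe])⟩

/-- The connecting homomorphism `ker (L ⊗ A → M ⊗ A) → Tor₁(H, A)` of a presentation
`L → M → H → 0` with `M` flat. -/
noncomputable def connecting :
    LinearMap.ker (Q.b.rTensor A) →ₗ[R] (torOne.{u, v} R A).obj (ModuleCat.of R H) :=
  factorSurjective (Q.sumMap A) (Q.sumMap_surjective A)
    -- Well-definedness: if `f₁ y + k = 0`, then `f₁ y` lies in `tensorKer`, hence so does `y`, and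
    -- its class in `Tor₁` is zero.
    (torClass (projectiveResolution (ModuleCat.of R H)) A ∘ₗ LinearMap.fst R _ _) (by
      rintro ⟨y, k⟩ hz
      have h : Q.lift.f₁.rTensor A y + k = 0 := congrArg Subtype.val hz
      refine (torClass_eq_zero_iff _ y).mpr (mem_tensorKer_of_map_mem Q.lift.comm
        (Q.lift.mem_range_of_mem_range Function.injective_id)
        (Q.lift.exists_sub_mem_range Function.surjective_id) y.2 ?_)
      rw [eq_neg_of_add_eq_zero_left h]
      exact neg_mem k.2)

variable {A}

theorem connecting_sumMap (z : LinearMap.ker ((d (projectiveResolution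
    (ModuleCat.of R H))).rTensor A) × tensorKer A Q.b) :
    Q.connecting A (Q.sumMap A z) = torClass (projectiveResolution (ModuleCat.of R H)) A z.1 :=
  factorSurjective_apply _ _ _ _ _

theorem connecting_surjective : Function.Surjective (Q.connecting A) := by
  intro t
  obtain ⟨y, rfl⟩ := torClass_surjective (projectiveResolution (ModuleCat.of R H)) A t
  exact ⟨_, Q.connecting_sumMap (y, 0)⟩

/-- The kernel is the part of `ker (b ⊗ A)` that comes from `ker b ⊗ A`; this becomes exactness in
the middle of the final sequence. -/
theorem connecting_eq_zero_iff (x : LinearMap.ker (Q.b.rTensor A)) :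
    Q.connecting A x = 0 ↔ (x : L ⊗[R] A) ∈ tensorKer A Q.b := by
  constructor
  · intro h
    obtain ⟨⟨y, k⟩, rfl⟩ := Q.sumMap_surjective A x
    rw [connecting_sumMap, torClass_eq_zero_iff] at h
    refine add_mem (rTensor_map_tensorKer _ (fun t ht => ?_) h) k.2
    rw [Q.lift.comm, ht, map_zero]
  · intro hx
    have : x = Q.sumMap A (0, ⟨x, hx⟩) := Subtype.ext (by simp [sumMap_coe])
    rw [this, connecting_sumMap, map_zero]

theorem connecting_congr {x x' : LinearMap.ker (Q.b.rTensor A)}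
    (h : (x - x' : L ⊗[R] A) ∈ tensorKer A Q.b) : Q.connecting A x = Q.connecting A x' := by
  rw [← sub_eq_zero, ← map_sub, connecting_eq_zero_iff]
  exact h

/-- Any lift of the identity may replace the chosen one, since two lifts differ by an element of
`tensorKer`. -/
theorem connecting_lift (F : Q.Lift (projectiveResolution (ModuleCat.of R H)) LinearMap.id)
    (y : LinearMap.ker ((d (projectiveResolution (ModuleCat.of R H))).rTensor A)) :
    Q.connecting A ⟨F.f₁.rTensor A y, F.rTensor_mem_ker y.2⟩ =
      torClass (projectiveResolution (ModuleCat.of R H)) A y := by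
  rw [← Q.connecting_sumMap (y, 0)]
  refine Q.connecting_congr ?_
  rw [sumMap_coe, Submodule.coe_zero, add_zero]
  exact F.sub_mem_tensorKer Q.lift y.2

theorem torOneMap_connecting {B : Type v} [AddCommGroup B] [Module R B] (α : A →ₗ[R] B)
    (x : LinearMap.ker (Q.b.rTensor A)) :
    ((torOneMap.{u, v} α).app (ModuleCat.of R H)).hom (Q.connecting A x) =
      Q.connecting B ⟨α.lTensor _ x, lTensor_mem_ker α x.2⟩ := by
  obtain ⟨⟨y, k⟩, rfl⟩ := Q.sumMap_surjective A x
  rw [connecting_sumMap, torOneMap_torClass, ← Q.connecting_lift Q.lift]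
  refine (Q.connecting_congr ?_).symm
  change α.lTensor L (Q.lift.f₁.rTensor A y + k) - Q.lift.f₁.rTensor B (α.lTensor _ y) ∈ _
  rw [map_add, ← rTensor_lTensor_apply, add_sub_cancel_left]
  exact lTensor_map_tensorKer α k.2

variable {Q} {L' H' : Type u} [AddCommGroup L'] [Module R L'] [AddCommGroup H'] [Module R H']
  {Q' : FlatPresentation (R := R) L' H'}

/-- The resolution of `H` reaches `Q'` in two ways: through the resolution of `H'`, or through `Q`.
Both are lifts of `g`, so they agree modulo `tensorKer`, where `connecting` vanishes. -/
theorem torOne_map_connecting (g₁ : L →ₗ[R] L') (g₀ : Q.M →ₗ[R] Q'.M) (g : H →ₗ[R] H')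
    (hb : ∀ x, Q'.b (g₁ x) = g₀ (Q.b x)) (hp : ∀ m, Q'.p (g₀ m) = g (Q.p m))
    (x : LinearMap.ker (Q.b.rTensor A)) (hx : g₁.rTensor A x ∈ LinearMap.ker (Q'.b.rTensor A)) :
    ((torOne.{u, v} R A).map (ModuleCat.ofHom g)).hom (Q.connecting A x) =
      Q'.connecting A ⟨g₁.rTensor A x, hx⟩ := by
  obtain ⟨⟨y, k⟩, rfl⟩ := Q.sumMap_surjective A x
  let φ := ProjectiveResolution.lift (ModuleCat.ofHom g) (projectiveResolution (ModuleCat.of R H))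
    (projectiveResolution (ModuleCat.of R H'))
  have hφ : φ.f 0 ≫ (projectiveResolution (ModuleCat.of R H')).π.f 0 =
      (projectiveResolution (ModuleCat.of R H)).π.f 0 ≫ ModuleCat.ofHom g :=
    ProjectiveResolution.lift_commutes_zero _ _ _
  have hφ' : ∀ z, aug (projectiveResolution (ModuleCat.of R H')) ((φ.f 0).hom z) =
      g (aug (projectiveResolution (ModuleCat.of R H)) z) := ConcreteCategory.congr_hom hφ
  have hd : ∀ z, d (projectiveResolution (ModuleCat.of R H')) ((φ.f 1).hom z) =
      (φ.f 0).hom (d (projectiveResolution (ModuleCat.of R H)) z) :=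
    fun z => (ConcreteCategory.congr_hom (φ.comm 1 0) z)
  have hy : (φ.f 1).hom.rTensor A y ∈
      LinearMap.ker ((d (projectiveResolution (ModuleCat.of R H'))).rTensor A) := by
    have h : d (projectiveResolution (ModuleCat.of R H')) ∘ₗ (φ.f 1).hom =
      (φ.f 0).hom ∘ₗ d (projectiveResolution (ModuleCat.of R H)) := LinearMap.ext hd
    rw [LinearMap.mem_ker, ← LinearMap.rTensor_comp_apply, h, LinearMap.rTensor_comp_apply,
      LinearMap.mem_ker.mp y.2, map_zero]
  rw [connecting_sumMap, torOne_map_torClass _ φ hφ y hy, ← Q'.connecting_lift Q'.lift]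
  refine Q'.connecting_congr ?_
  let F : Q'.Lift (projectiveResolution (ModuleCat.of R H)) g :=
    { f₁ := Q'.lift.f₁ ∘ₗ (φ.f 1).hom
      f₀ := Q'.lift.f₀ ∘ₗ (φ.f 0).hom
      comm := fun z => (Q'.lift.comm _).trans (congrArg Q'.lift.f₀ (hd z))
      aug := fun z => (Q'.lift.aug _).trans (hφ' z) }
  let F' : Q'.Lift (projectiveResolution (ModuleCat.of R H)) g :=
    { f₁ := g₁ ∘ₗ Q.lift.f₁
      f₀ := g₀ ∘ₗ Q.lift.f₀
      comm := fun z => (hb _).trans (congrArg g₀ (Q.lift.comm z))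
      aug := fun z => (hp _).trans (congrArg g (Q.lift.aug z)) }
  have h1 := F.sub_mem_tensorKer F' y.2
  have h2 : g₁.rTensor A k ∈ tensorKer A Q'.b :=
    rTensor_map_tensorKer g₁ (fun t ht => by rw [hb, ht, map_zero]) k.2
  have h3 := sub_mem h1 h2
  rw [sub_sub] at h3
  change Q'.lift.f₁.rTensor A ((φ.f 1).hom.rTensor A y) -
    g₁.rTensor A (Q.lift.f₁.rTensor A y + k) ∈ _
  rw [map_add, ← LinearMap.rTensor_comp_apply, ← LinearMap.rTensor_comp_apply]
  exact h3

end FlatPresentation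

end Connecting

/-! ### Compactly supported functions with discrete coefficients -/

section Coefficients

open TensorProduct

variable {X Y : Type*} [TopologicalSpace X] [TopologicalSpace Y]

/-- The homomorphism `f ↦ f • a` from `C_c(X, ℤ)` to `C_c(X, A)`. -/
noncomputable def smulCoeff (X : Type*) [TopologicalSpace X] {A : Type*}
    [AddCommGroup A] [TopologicalSpace A] [IsTopologicalAddGroup A] (a : A) :
    C_c(X, ℤ) →ₗ[ℤ] C_c(X, A) :=
  coeffMap X (zmultiplesHom A a) continuous_of_discreteTopology

section Topological

variable {A : Type*} [AddCommGroup A] [TopologicalSpace A] [IsTopologicalAddGroup A]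

theorem smulCoeff_apply (a : A) (f : C_c(X, ℤ)) (x : X) : smulCoeff X a f x = f x • a := rfl

variable (X A) in
/-- The homomorphism `C_c(X, ℤ) ⊗ A → C_c(X, A)`. -/
noncomputable def tensorCoeff : C_c(X, ℤ) ⊗[ℤ] A →ₗ[ℤ] C_c(X, A) :=
  TensorProduct.lift (LinearMap.mk₂ ℤ (fun f a => smulCoeff X a f)
    (fun f g a => map_add _ f g) (fun n f a => map_smul _ n f)
    (fun f a b => by ext x; exact smul_add (f x) a b)
    (fun n f a => by ext x; exact smul_comm (f x) n a))

theorem tensorCoeff_tmul (f : C_c(X, ℤ)) (a : A) :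
    tensorCoeff X A (f ⊗ₜ a) = smulCoeff X a f := rfl

theorem tensorCoeff_pushforward [T2Space X] [T2Space Y] {φ : X → Y} (hφ : IsLocalHomeomorph φ)
    (z : C_c(X, ℤ) ⊗[ℤ] A) :
    tensorCoeff Y A ((pushforward φ hφ).rTensor A z) = pushforward φ hφ (tensorCoeff X A z) := by
  induction z with
  | zero => simp only [map_zero]
  | add z w hz hw => simp only [map_add, hz, hw]
  | tmul f a =>
    exact coeffMap_pushforward hφ (zmultiplesHom A a) continuous_of_discreteTopology f

theorem tensorCoeff_lTensor {B : Type*} [AddCommGroup B] [TopologicalSpace B]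
    [IsTopologicalAddGroup B] (α : A →+ B) (hα : Continuous α) (z : C_c(X, ℤ) ⊗[ℤ] A) :
    tensorCoeff X B (α.toIntLinearMap.lTensor _ z) = coeffMap X α hα (tensorCoeff X A z) := by
  induction z with
  | zero => simp only [map_zero]
  | add z w hz hw => simp only [map_add, hz, hw]
  | tmul f a =>
    ext x
    exact (map_zsmul α (f x) a).symm

end Topological

instance : Module.IsTorsionFree ℤ C_c(X, ℤ) :=
  DFunLike.coe_injective.moduleIsTorsionFree (fun f : C_c(X, ℤ) => (f : X → ℤ)) fun _ _ => rfl

section Discrete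

variable {V : Type*} [AddCommGroup V] [TopologicalSpace V] [DiscreteTopology V]

theorem finite_range_of_discrete (g : C_c(X, V)) : (Set.range g).Finite :=
  (g.hasCompactSupport.isCompact_range g.continuous).finite_of_discrete

open Classical in
/-- The indicator function of the set on which `g` takes the nonzero value `v`. -/
noncomputable def levelIndicator (g : C_c(X, V)) (v : V) : C_c(X, ℤ) :=
  -- The condition `v ≠ 0` makes the outer function vanish at `0`, as `compLeft` needs to preserve
  -- compact support; the zero level set need not be compact.
  g.compLeft ⟨fun w => if v ≠ 0 ∧ w = v then 1 else 0, continuous_of_discreteTopology⟩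

open Classical in
theorem levelIndicator_apply (g : C_c(X, V)) (v : V) (x : X) :
    levelIndicator g v x = if v ≠ 0 ∧ g x = v then 1 else 0 := by
  have h : (⟨fun w => if v ≠ 0 ∧ w = v then 1 else 0, continuous_of_discreteTopology⟩ :
      C(V, ℤ)) 0 = 0 := if_neg fun h => h.1 h.2.symm
  exact congrFun (CompactlySupportedContinuousMap.coe_compLeft h g) x

/-- A function that factors through `g` is a combination of the indicators of the level sets
of `g`. -/
theorem eq_sum_smulCoeff_levelIndicator {B : Type*} [AddCommGroup B] [TopologicalSpace B]
    [IsTopologicalAddGroup B] (g : C_c(X, V)) (f : C_c(X, B)) (h : V → B) (h0 : h 0 = 0)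
    (hf : ∀ x, f x = h (g x)) :
    f = ∑ v ∈ (finite_range_of_discrete g).toFinset, smulCoeff X (h v) (levelIndicator g v) := by
  ext x
  rw [CompactlySupportedContinuousMap.coe_sum, Finset.sum_apply, hf,
    Finset.sum_eq_single_of_mem (g x) ((finite_range_of_discrete g).mem_toFinset.mpr ⟨x, rfl⟩)]
  · by_cases hx : g x = 0 <;> simp [smulCoeff_apply, levelIndicator_apply, hx, h0]
  · intro v _ hv
    simp [smulCoeff_apply, levelIndicator_apply, Ne.symm hv]

variable {A : Type*} [AddCommGroup A] [TopologicalSpace A] [DiscreteTopology A]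

theorem tensorCoeff_surjective : Function.Surjective (tensorCoeff X A) := by
  intro f
  refine ⟨∑ v ∈ (finite_range_of_discrete f).toFinset, levelIndicator f v ⊗ₜ v, ?_⟩
  rw [map_sum]
  exact (eq_sum_smulCoeff_levelIndicator f f id rfl fun _ => rfl).symm

/-- The function with components in a finite set of compactly supported functions. -/
def jointly [R1Space X] {ι : Type*} [Finite ι] (f : ι → C_c(X, ℤ)) : C_c(X, ι → ℤ) where
  toFun x i := f i x
  continuous_toFun := continuous_pi fun i => (f i).continuous
  hasCompactSupport' := by
    refine HasCompactSupport.intro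
      (isCompact_iUnion fun i => (f i).hasCompactSupport.isCompact) fun x hx => ?_
    funext i
    exact image_eq_zero_of_notMem_tsupport fun h => hx (Set.mem_iUnion_of_mem i h)

/-- The finitely many functions occurring in a tensor are all combinations of the level indicators
of their joint function `g`. Rewriting `∑ fᵢ ⊗ aᵢ` over these indicators, the coefficient at `v` is
`∑ vᵢ aᵢ`. -/
theorem tensorCoeff_injective [R1Space X] : Function.Injective (tensorCoeff X A) := by
  rw [injective_iff_map_eq_zero]
  intro z hz
  obtain ⟨S, rfl⟩ := TensorProduct.exists_finset z
  let g : C_c(X, S → ℤ) := jointly fun i : S => i.1.1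
  set T := (finite_range_of_discrete g).toFinset
  have hdec : ∀ i : S, i.1.1 = ∑ v ∈ T, v i • levelIndicator g v := by
    intro i
    refine (eq_sum_smulCoeff_levelIndicator g i.1.1 (fun v => v i) rfl fun _ => rfl).trans ?_
    refine Finset.sum_congr rfl fun v _ => ?_
    ext x
    exact mul_comm _ _
  have hval : ∀ x, ∑ i : S, g x i • i.1.2 = 0 := by
    intro x
    have := DFunLike.congr_fun hz x
    rw [map_sum, CompactlySupportedContinuousMap.coe_sum, Finset.sum_apply,
      ← Finset.sum_coe_sort] at this
    exact this
  -- Every `v` in `T` is attained by `g` at some `x`, so this coefficient is the value at `x` of a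
  -- function that is zero.
  have hv : ∀ v ∈ T, ∑ i : S, v i • i.1.2 = 0 := by
    intro v hv
    obtain ⟨x, rfl⟩ := (Set.Finite.mem_toFinset _).mp hv
    exact hval x
  calc ∑ i ∈ S, i.1 ⊗ₜ[ℤ] i.2 = ∑ i : S, ∑ v ∈ T, levelIndicator g v ⊗ₜ[ℤ] (v i • i.1.2) := by
        rw [← Finset.sum_coe_sort]
        refine Finset.sum_congr rfl fun i _ => ?_
        conv_lhs => rw [hdec i, TensorProduct.sum_tmul]
        exact Finset.sum_congr rfl fun v _ => TensorProduct.smul_tmul _ _ _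
    _ = ∑ v ∈ T, levelIndicator g v ⊗ₜ[ℤ] ∑ i : S, v i • i.1.2 := by
        rw [Finset.sum_comm]
        exact Finset.sum_congr rfl fun v _ => (TensorProduct.tmul_sum _ _ _).symm
    _ = 0 := Finset.sum_eq_zero fun v h => by rw [hv v h, TensorProduct.tmul_zero]

variable (X A) in
/-- The isomorphism `C_c(X, ℤ) ⊗ A ≃ C_c(X, A)` for a discrete group `A`. -/
noncomputable def tensorCoeffEquiv [R1Space X] : C_c(X, ℤ) ⊗[ℤ] A ≃ₗ[ℤ] C_c(X, A) :=
  LinearEquiv.ofBijective (tensorCoeff X A) ⟨tensorCoeff_injective, tensorCoeff_surjective⟩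

end Discrete

end Coefficients

/-! ### Universal coefficients for torsion-free complexes over a Dedekind domain -/

section UniversalCoefficients

open TensorProduct

variable {R : Type} [CommRing R]

/-- Truncated subtraction matches the convention `next 0 = 0`. Since `d 0 0 = 0`, the kernel of `d n
(n - 1)` is the right module of cycles in degree `0` too, so no case split is needed. -/
theorem next_down_nat (n : ℕ) : (ComplexShape.down ℕ).next n = n - 1 := by
  cases n <;> simp

theorem prev_down_nat (n : ℕ) : (ComplexShape.down ℕ).prev n = n + 1 := by simp

/-- The homology class of a cycle of `C`. -/
noncomputable abbrev cls (C : ChainComplex (ModuleCat.{v} R) ℕ) (n : ℕ) :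
    LinearMap.ker (C.d n (n - 1)).hom →ₗ[R] C.homology n :=
  homologyClass C n (n - 1) (next_down_nat n)

theorem cls_surjective {C : ChainComplex (ModuleCat.{v} R) ℕ} {n : ℕ} :
    Function.Surjective (cls C n) :=
  homologyClass_surjective _

theorem cls_eq_zero_iff {C : ChainComplex (ModuleCat.{v} R) ℕ} {n : ℕ}
    (x : LinearMap.ker (C.d n (n - 1)).hom) :
    cls C n x = 0 ↔ ∃ w, (C.d (n + 1) n).hom w = x :=
  homologyClass_eq_zero_iff _ (prev_down_nat n) x

/-- The map induced on cycles by a chain map. -/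
def cyclesRestrict {K K' : ChainComplex (ModuleCat.{v} R) ℕ} (f : K ⟶ K') (n : ℕ) :
    LinearMap.ker (K.d n (n - 1)).hom →ₗ[R] LinearMap.ker (K'.d n (n - 1)).hom :=
  (f.f n).hom.restrict fun x hx => by
    refine (ConcreteCategory.congr_hom (f.comm n (n - 1)) x).trans ?_
    exact (congrArg (f.f (n - 1)).hom hx).trans (map_zero _)

theorem homologyMap_cls {K K' : ChainComplex (ModuleCat.{v} R) ℕ} (f : K ⟶ K')
    {n : ℕ} (x : LinearMap.ker (K.d n (n - 1)).hom) :
    (HomologicalComplex.homologyMap f n).hom (cls K n x) = cls K' n (cyclesRestrict f n x) :=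
  homologyMap_homologyClass _ f x (cyclesRestrict f n x).2

/-- A presentation `C_n → M → H → 0` where `M` is a pure subgroup of `C_{n-1}`, for `n ≥ 1`
the group of cycles. -/
structure BoundaryPresentation (C : ChainComplex (ModuleCat.{u} R) ℕ) (n : ℕ) (H : ModuleCat.{u} R)
    extends FlatPresentation (R := R) (C.X n) H where
  i : M →ₗ[R] C.X (n - 1)
  i_b : ∀ x, i (b x) = (C.d n (n - 1)).hom x
  i_injective : Function.Injective i
  N : Type u
  [addCommGroupN : AddCommGroup N]
  [moduleN : Module R N]
  [torsionFree : Module.IsTorsionFree R N]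
  q : C.X (n - 1) →ₗ[R] N
  exact_i_q : Function.Exact i q

attribute [instance] BoundaryPresentation.addCommGroupN BoundaryPresentation.moduleN
  BoundaryPresentation.torsionFree

/-- The cokernel of `i` is `range q`, a submodule of a torsion-free module; over a Dedekind domain
it is therefore flat. -/
theorem rTensor_injective_of_exact_of_torsionFree [IsDedekindDomain R] {L M N A : Type*}
    [AddCommGroup L] [Module R L] [AddCommGroup M] [Module R M] [AddCommGroup N] [Module R N]
    [Module.IsTorsionFree R N] [AddCommGroup A] [Module R A]
    {i : L →ₗ[R] M} {q : M →ₗ[R] N} (hi : Function.Injective i) (h : Function.Exact i q) :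
    Function.Injective (i.rTensor A) := by
  refine rTensor_injective_of_exact_of_flat hi q.surjective_rangeRestrict ?_
  rw [LinearMap.exact_iff, LinearMap.ker_rangeRestrict, ← LinearMap.exact_iff]
  exact h

namespace BoundaryPresentation

variable {C C' : ChainComplex (ModuleCat.{u} R) ℕ}

/-- The presentation `C_0 → 0 → 0 → 0`. -/
def zero (C : ChainComplex (ModuleCat.{u} R) ℕ)
    [∀ n, Module.IsTorsionFree R (C.X n)] :
    BoundaryPresentation C 0 (ModuleCat.of R PUnit.{u + 1}) where
  M := PUnit.{u + 1}
  b := (0 : C.X 0 →ₗ[R] PUnit.{u + 1})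
  p := LinearMap.id
  exact := fun _ => ⟨fun _ => ⟨0, rfl⟩, fun _ => rfl⟩
  surjective := Function.surjective_id
  i := (0 : PUnit.{u + 1} →ₗ[R] C.X 0)
  -- Here `0 - 1 = 0`, and the component `d 0 0` of the differential is zero.
  i_b := fun x => by simp
  i_injective := Function.injective_of_subsingleton _
  N := C.X 0
  q := LinearMap.id
  exact_i_q := fun x => ⟨fun h => ⟨0, h.symm⟩, fun ⟨_, h⟩ => h.symm⟩

/-- The presentation of the homology in degree `n` by the boundary map `C_{n+1} → Z_n`. -/
noncomputable def succ [IsDedekindDomain R] (C : ChainComplex (ModuleCat.{u} R) ℕ)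
    [∀ n, Module.IsTorsionFree R (C.X n)] (n : ℕ) :
    BoundaryPresentation C (n + 1) (C.homology n) where
  M := LinearMap.ker (C.d n (n - 1)).hom
  b := (C.d (n + 1) n).hom.codRestrict _
    fun x => ConcreteCategory.congr_hom (C.d_comp_d (n + 1) n (n - 1)) x
  p := homologyClass C n (n - 1) (next_down_nat n)
  exact := fun x => (homologyClass_eq_zero_iff _ (prev_down_nat n) x).trans
    ⟨fun ⟨w, hw⟩ => ⟨w, Subtype.ext hw⟩, fun ⟨w, hw⟩ => ⟨w, congrArg Subtype.val hw⟩⟩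
  surjective := homologyClass_surjective _
  i := (LinearMap.ker (C.d n (n - 1)).hom).subtype
  i_b := fun _ => rfl
  i_injective := Subtype.val_injective
  N := C.X (n - 1)
  q := (C.d n (n - 1)).hom
  exact_i_q := LinearMap.exact_subtype_ker_map _

variable {n : ℕ} {H : ModuleCat.{u} R} (Q : BoundaryPresentation C n H) {A : Type v}
  [AddCommGroup A] [Module R A]

theorem b_eq_zero_iff (x : C.X n) : Q.b x = 0 ↔ (C.d n (n - 1)).hom x = 0 := by
  rw [← Q.i_b, map_eq_zero_iff _ Q.i_injective]

/-- Purity of `M` in `C_{n-1}`: shrinking the target of the differential from `C_{n-1}` to `M` does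
not change the kernel after tensoring. -/
theorem rTensor_b_eq_zero_iff [IsDedekindDomain R] (x : C.X n ⊗[R] A) :
    Q.b.rTensor A x = 0 ↔ (C.d n (n - 1)).hom.rTensor A x = 0 := by
  have h : (C.d n (n - 1)).hom = Q.i ∘ₗ Q.b := LinearMap.ext fun x => (Q.i_b x).symm
  rw [h, LinearMap.rTensor_comp_apply,
    map_eq_zero_iff _ (rTensor_injective_of_exact_of_torsionFree Q.i_injective Q.exact_i_q)]

theorem tensorKer_b : tensorKer A Q.b = tensorKer A (C.d n (n - 1)).hom := by
  refine le_antisymm ?_ ?_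
  · rintro _ ⟨z, rfl⟩
    exact rTensor_mem_tensorKer _ (fun t => (Q.b_eq_zero_iff _).mp t.2) z
  · rintro _ ⟨z, rfl⟩
    exact rTensor_mem_tensorKer _ (fun t => (Q.b_eq_zero_iff _).mpr t.2) z

/-- A morphism of presentations over a chain map and a map of the presented modules. -/
structure Map {n : ℕ} {H H' : ModuleCat.{u} R} (Q : BoundaryPresentation C n H)
    (Q' : BoundaryPresentation C' n H') (f : C ⟶ C') (φ : H ⟶ H') where
  g : Q.M →ₗ[R] Q'.M
  g_b : ∀ x, Q'.b ((f.f n).hom x) = g (Q.b x)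
  p_g : ∀ m, Q'.p (g m) = φ.hom (Q.p m)

section

variable [IsDedekindDomain R] [∀ n, Module.IsTorsionFree R (C.X n)]
  [∀ n, Module.IsTorsionFree R (C'.X n)] (f : C ⟶ C')

/-- The morphism of presentations in degree `0`. -/
def Map.zero : Map (BoundaryPresentation.zero C) (BoundaryPresentation.zero C') f (𝟙 _) where
  g := LinearMap.id
  g_b := fun _ => rfl
  p_g := fun _ => rfl

/-- The morphism of presentations in positive degrees. -/
noncomputable def Map.succ (n : ℕ) : Map (BoundaryPresentation.succ C n)
    (BoundaryPresentation.succ C' n) f (HomologicalComplex.homologyMap f n) where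
  g := cyclesRestrict f n
  g_b := fun x => Subtype.ext (ConcreteCategory.congr_hom (f.comm (n + 1) n) x)
  p_g := fun m => (homologyMap_cls f m).symm

end

end BoundaryPresentation

/-- An identification of `D` with the complex `C ⊗ A`. -/
structure TensorComparison (C : ChainComplex (ModuleCat.{u} R) ℕ) (A : Type v)
    [AddCommGroup A] [Module R A] (D : ChainComplex (ModuleCat.{max u v} R) ℕ) where
  e : ∀ n, C.X n ⊗[R] A ≃ₗ[R] D.X n
  comm : ∀ i j x, e j ((C.d i j).hom.rTensor A x) = (D.d i j).hom (e i x)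

namespace TensorComparison

variable {C : ChainComplex (ModuleCat.{u} R) ℕ} {A : Type v} [AddCommGroup A] [Module R A]
  {D : ChainComplex (ModuleCat.{max u v} R) ℕ} (E : TensorComparison C A D) (n : ℕ)

/-- The map `Z_n(C) ⊗ A → Z_n(D)`. -/
noncomputable def cycleMap :
    LinearMap.ker (C.d n (n - 1)).hom ⊗[R] A →ₗ[R] LinearMap.ker (D.d n (n - 1)).hom :=
  ((E.e n).toLinearMap ∘ₗ
    (LinearMap.ker (C.d n (n - 1)).hom).subtype.rTensor A).codRestrict _ fun z => by
      change (D.d n (n - 1)).hom (E.e n _) = 0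
      have h : (C.d n (n - 1)).hom ∘ₗ (LinearMap.ker (C.d n (n - 1)).hom).subtype = 0 :=
        LinearMap.ext fun t => t.2
      rw [← E.comm, ← LinearMap.rTensor_comp_apply, h, LinearMap.rTensor_zero,
        LinearMap.zero_apply, map_zero]

theorem cycleMap_coe (z : LinearMap.ker (C.d n (n - 1)).hom ⊗[R] A) :
    (E.cycleMap n z : D.X n) =
      E.e n ((LinearMap.ker (C.d n (n - 1)).hom).subtype.rTensor A z) := rfl

/-- Makes `kappa` well defined: by right exactness on `C_{n+1} → Z_n → H_n → 0`, the kernel of `Z_n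
⊗ A → H_n ⊗ A` is the image of `C_{n+1} ⊗ A`. -/
theorem exists_boundary (z : LinearMap.ker (C.d n (n - 1)).hom ⊗[R] A)
    (hz : (cls C n).rTensor A z = 0) : ∃ w, (D.d (n + 1) n).hom w = E.cycleMap n z := by
  let d' : C.X (n + 1) →ₗ[R] LinearMap.ker (C.d n (n - 1)).hom :=
    (C.d (n + 1) n).hom.codRestrict _
      fun x => ConcreteCategory.congr_hom (C.d_comp_d (n + 1) n (n - 1)) x
  have hex : Function.Exact d' (cls C n) := fun x => (cls_eq_zero_iff x).trans
    ⟨fun ⟨w, hw⟩ => ⟨w, Subtype.ext hw⟩, fun ⟨w, hw⟩ => ⟨w, congrArg Subtype.val hw⟩⟩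
  obtain ⟨w, rfl⟩ := (rTensor_exact A hex cls_surjective z).mp hz
  refine ⟨E.e (n + 1) w, ?_⟩
  rw [cycleMap_coe, ← E.comm, ← LinearMap.rTensor_comp_apply]
  rfl

/-- The homomorphism `H_n(C) ⊗ A → H_n(C ⊗ A)`. -/
noncomputable def kappa : C.homology n ⊗[R] A →ₗ[R] D.homology n :=
  factorSurjective ((cls C n).rTensor A)
    (LinearMap.rTensor_surjective A cls_surjective)
    (cls D n ∘ₗ E.cycleMap n)
    (fun z hz => (cls_eq_zero_iff _).mpr (E.exists_boundary n z hz))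

theorem kappa_cls (z : LinearMap.ker (C.d n (n - 1)).hom ⊗[R] A) :
    E.kappa n ((cls C n).rTensor A z) = cls D n (E.cycleMap n z) :=
  factorSurjective_apply _ _ _ _ _

theorem kappa_injective [IsDedekindDomain R] [∀ n, Module.IsTorsionFree R (C.X n)] :
    Function.Injective (E.kappa n) := by
  rw [injective_iff_map_eq_zero]
  intro t ht
  obtain ⟨z, rfl⟩ := LinearMap.rTensor_surjective A cls_surjective t
  rw [kappa_cls, cls_eq_zero_iff] at ht
  obtain ⟨w, hw⟩ := ht
  obtain ⟨w, rfl⟩ := (E.e (n + 1)).surjective w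
  let d' : C.X (n + 1) →ₗ[R] LinearMap.ker (C.d n (n - 1)).hom :=
    (C.d (n + 1) n).hom.codRestrict _
      fun x => ConcreteCategory.congr_hom (C.d_comp_d (n + 1) n (n - 1)) x
  rw [cycleMap_coe, ← E.comm, EmbeddingLike.apply_eq_iff_eq] at hw
  -- The two sides agree in `C_n ⊗ A`; they agree already in `Z_n ⊗ A` because `C_n / Z_n` embeds in
  -- the torsion-free module `C_{n-1}`.
  have hz : z = d'.rTensor A w := by
    refine rTensor_injective_of_exact_of_torsionFree Subtype.val_injective
      (LinearMap.exact_subtype_ker_map (C.d n (n - 1)).hom) ?_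
    rw [← hw, ← LinearMap.rTensor_comp_apply]
    rfl
  have h0 : cls C n ∘ₗ d' = 0 := LinearMap.ext fun x => (cls_eq_zero_iff _).mpr ⟨x, rfl⟩
  change (cls C n).rTensor A z = 0
  rw [hz, ← LinearMap.rTensor_comp_apply, h0, LinearMap.rTensor_zero, LinearMap.zero_apply]

variable {n}

variable {A' : Type v} [AddCommGroup A'] [Module R A'] {C' : ChainComplex (ModuleCat.{u} R) ℕ}
  {D' : ChainComplex (ModuleCat.{max u v} R) ℕ}

variable {E} in
theorem kappa_coeff {E' : TensorComparison C A' D'} (α : A →ₗ[R] A') (g : D ⟶ D')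
    (h : ∀ x, E'.e n (α.lTensor _ x) = (g.f n).hom (E.e n x)) (t : C.homology n ⊗[R] A) :
    E'.kappa n (α.lTensor _ t) = (HomologicalComplex.homologyMap g n).hom (E.kappa n t) := by
  obtain ⟨z, rfl⟩ := LinearMap.rTensor_surjective A cls_surjective t
  rw [← rTensor_lTensor_apply]
  refine (E'.kappa_cls n _).trans (Eq.symm ?_)
  refine (congrArg _ (E.kappa_cls n z)).trans ((homologyMap_cls g _).trans ?_)
  refine congrArg _ (Subtype.ext ?_)
  rw [cycleMap_coe, rTensor_lTensor_apply, h]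
  rfl

variable {E} in
theorem kappa_map {E' : TensorComparison C' A D'} (f : C ⟶ C') (g : D ⟶ D')
    (h : ∀ x, E'.e n ((f.f n).hom.rTensor A x) = (g.f n).hom (E.e n x))
    (t : C.homology n ⊗[R] A) :
    E'.kappa n ((HomologicalComplex.homologyMap f n).hom.rTensor A t) =
      (HomologicalComplex.homologyMap g n).hom (E.kappa n t) := by
  obtain ⟨z, rfl⟩ := LinearMap.rTensor_surjective A cls_surjective t
  have h1 : (HomologicalComplex.homologyMap f n).hom ∘ₗ cls C n =
      cls C' n ∘ₗ cyclesRestrict f n := LinearMap.ext (homologyMap_cls f)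
  rw [← LinearMap.rTensor_comp_apply, h1, LinearMap.rTensor_comp_apply]
  refine (E'.kappa_cls n _).trans (Eq.symm ?_)
  refine (congrArg _ (E.kappa_cls n z)).trans ((homologyMap_cls g _).trans ?_)
  refine congrArg _ (Subtype.ext ?_)
  refine (h _).symm.trans ?_
  rw [cycleMap_coe, ← LinearMap.rTensor_comp_apply, ← LinearMap.rTensor_comp_apply]
  rfl

variable (n) in
/-- The map `H_n(C) ⊗ A → H_n(C ⊗ A)` as a morphism of `ModuleCat R`. -/
noncomputable def kappaHom : (tensorFunctor.{u, v} R A).obj (C.homology n) ⟶ D.homology n :=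
  ModuleCat.ofHom (E.kappa n)

variable {E} in
theorem tensorFunctorMap_app_kappaHom {E' : TensorComparison C A' D'} (α : A →ₗ[R] A') (g : D ⟶ D')
    (h : ∀ x, E'.e n (α.lTensor _ x) = (g.f n).hom (E.e n x)) :
    (tensorFunctorMap.{u, v} α).app (C.homology n) ≫ E'.kappaHom n =
      E.kappaHom n ≫ HomologicalComplex.homologyMap g n :=
  ModuleCat.hom_ext (LinearMap.ext (kappa_coeff α g h))

variable {E} in
theorem tensorFunctor_map_kappaHom {E' : TensorComparison C' A D'} (f : C ⟶ C') (g : D ⟶ D')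
    (h : ∀ x, E'.e n ((f.f n).hom.rTensor A x) = (g.f n).hom (E.e n x)) :
    (tensorFunctor.{u, v} R A).map (HomologicalComplex.homologyMap f n) ≫ E'.kappaHom n =
      E.kappaHom n ≫ HomologicalComplex.homologyMap g n :=
  ModuleCat.hom_ext (LinearMap.ext (kappa_map f g h))

variable [IsDedekindDomain R] {H : ModuleCat.{u} R} (Q : BoundaryPresentation C n H)

/-- The map `Z_n(D) → ker (C_n ⊗ A → M ⊗ A)`. -/
noncomputable def toKer :
    LinearMap.ker (D.d n (n - 1)).hom →ₗ[R] LinearMap.ker (Q.b.rTensor A) :=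
  ((E.e n).symm.toLinearMap ∘ₗ (LinearMap.ker (D.d n (n - 1)).hom).subtype).codRestrict _
    fun y => by
      refine (Q.rTensor_b_eq_zero_iff _).mpr ((E.e (n - 1)).injective ?_)
      rw [E.comm, map_zero]
      exact (congrArg (D.d n (n - 1)).hom ((E.e n).apply_symm_apply y.1)).trans y.2

theorem toKer_coe (y : LinearMap.ker (D.d n (n - 1)).hom) :
    (E.toKer Q y : C.X n ⊗[R] A) = (E.e n).symm y := rfl

theorem toKer_surjective : Function.Surjective (E.toKer Q) := by
  rintro ⟨x, hx⟩
  refine ⟨⟨E.e n x, ?_⟩, Subtype.ext ((E.e n).symm_apply_apply x)⟩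
  rw [LinearMap.mem_ker, ← E.comm, (Q.rTensor_b_eq_zero_iff _).mp hx, map_zero]

/-- The homomorphism `H_n(C ⊗ A) → Tor₁(H, A)`. -/
noncomputable def iota : D.homology n →ₗ[R] (torOne.{u, v} R A).obj H :=
  factorSurjective (cls D n) cls_surjective (Q.connecting A ∘ₗ E.toKer Q) (by
    intro y hy
    obtain ⟨w, hw⟩ := (cls_eq_zero_iff y).mp hy
    obtain ⟨w, rfl⟩ := (E.e (n + 1)).surjective w
    -- A boundary of `C ⊗ A` comes from `C_{n+1} ⊗ A` through a map with values in `ker b`, so it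
    -- lies in `tensorKer` and `connecting` kills it.
    refine (Q.connecting_eq_zero_iff _).mpr ?_
    rw [toKer_coe, ← hw, ← E.comm, LinearEquiv.symm_apply_apply]
    exact rTensor_mem_tensorKer _ (fun t => (Q.b_eq_zero_iff _).mpr
      (ConcreteCategory.congr_hom (C.d_comp_d (n + 1) n (n - 1)) t)) w)

theorem iota_cls (y : LinearMap.ker (D.d n (n - 1)).hom) :
    E.iota Q (cls D n y) = Q.connecting A (E.toKer Q y) :=
  factorSurjective_apply _ _ _ _ _

theorem iota_surjective : Function.Surjective (E.iota Q) := by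
  intro t
  obtain ⟨x, rfl⟩ := Q.connecting_surjective (A := A) t
  obtain ⟨y, rfl⟩ := E.toKer_surjective Q x
  exact ⟨_, E.iota_cls Q y⟩

/-- Both conditions on the class of `y` say that `y` comes from `Z_n ⊗ A`: for the kernel of `iota`
by `connecting_eq_zero_iff`, for the image of `kappa` by its construction on cycles. -/
theorem exact_kappa_iota : Function.Exact (E.kappa n) (E.iota Q) := by
  intro x
  obtain ⟨y, rfl⟩ := cls_surjective x
  have h : E.iota Q (cls D n y) = 0 ↔ (E.e n).symm y ∈ tensorKer A (C.d n (n - 1)).hom := by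
    rw [iota_cls]
    exact (Q.connecting_eq_zero_iff _).trans (by rw [Q.tensorKer_b]; rfl)
  refine h.trans ⟨?_, ?_⟩
  · rintro ⟨z, hz⟩
    refine ⟨(cls C n).rTensor A z, (E.kappa_cls n z).trans (congrArg _ (Subtype.ext ?_))⟩
    rw [cycleMap_coe, hz, LinearEquiv.apply_symm_apply]
  · rintro ⟨t, ht⟩
    obtain ⟨z, rfl⟩ := LinearMap.rTensor_surjective A cls_surjective t
    refine h.mp (ht ▸ (congrArg (E.iota Q) (E.kappa_cls n z)).trans ?_)
    rw [iota_cls]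
    refine (Q.connecting_eq_zero_iff _).mpr ?_
    rw [Q.tensorKer_b]
    exact ⟨z, ((E.e n).symm_apply_apply _).symm⟩

variable {E} in
theorem iota_coeff {E' : TensorComparison C A' D'} (α : A →ₗ[R] A') (g : D ⟶ D')
    (h : ∀ x, E'.e n (α.lTensor _ x) = (g.f n).hom (E.e n x)) (t : D.homology n) :
    E'.iota Q ((HomologicalComplex.homologyMap g n).hom t) =
      ((torOneMap.{u, v} α).app H).hom (E.iota Q t) := by
  obtain ⟨y, rfl⟩ := cls_surjective t
  refine (congrArg _ (homologyMap_cls g y)).trans ((E'.iota_cls Q _).trans (Eq.symm ?_))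
  refine (congrArg _ (E.iota_cls Q y)).trans ((Q.torOneMap_connecting α _).trans ?_)
  refine congrArg _ (Subtype.ext ?_)
  refine (E'.e n).injective ((h _).trans ?_)
  rw [toKer_coe, toKer_coe, LinearEquiv.apply_symm_apply, LinearEquiv.apply_symm_apply]
  rfl

variable {E Q} in
theorem iota_map {E' : TensorComparison C' A D'} {H' : ModuleCat.{u} R}
    {Q' : BoundaryPresentation C' n H'} (f : C ⟶ C') (g : D ⟶ D')
    (h : ∀ x, E'.e n ((f.f n).hom.rTensor A x) = (g.f n).hom (E.e n x))
    {φ : H ⟶ H'} (m : Q.Map Q' f φ) (t : D.homology n) :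
    E'.iota Q' ((HomologicalComplex.homologyMap g n).hom t) =
      ((torOne.{u, v} R A).map φ).hom (E.iota Q t) := by
  obtain ⟨y, rfl⟩ := cls_surjective t
  refine (congrArg _ (homologyMap_cls g y)).trans ((E'.iota_cls Q' _).trans (Eq.symm ?_))
  have hy : (f.f n).hom.rTensor A (E.toKer Q y) =
      E'.toKer Q' (cyclesRestrict g n y) := by
    refine (E'.e n).injective ((h _).trans ?_)
    rw [toKer_coe, toKer_coe, LinearEquiv.apply_symm_apply, LinearEquiv.apply_symm_apply]
    rfl
  refine (congrArg _ (E.iota_cls Q y)).trans ((FlatPresentation.torOne_map_connecting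
    (f.f n).hom m.g φ.hom m.g_b m.p_g (E.toKer Q y)
    (by rw [hy]; exact Subtype.property _)).trans ?_)
  exact congrArg _ (Subtype.ext hy)

/-- The map `H_n(C ⊗ A) → Tor₁(H, A)` as a morphism of `ModuleCat R`. -/
noncomputable def iotaHom : D.homology n ⟶ (torOne.{u, v} R A).obj H :=
  ModuleCat.ofHom (E.iota Q)

variable {E} {E₁ : TensorComparison C A' D'} {E₂ : TensorComparison C' A D'}

theorem homologyMap_iotaHom_coeff (α : A →ₗ[R] A') (g : D ⟶ D')
    (h : ∀ x, E₁.e n (α.lTensor _ x) = (g.f n).hom (E.e n x)) :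
    HomologicalComplex.homologyMap g n ≫ E₁.iotaHom Q =
      E.iotaHom Q ≫ (torOneMap.{u, v} α).app H :=
  ModuleCat.hom_ext (LinearMap.ext (iota_coeff Q α g h))

variable {Q} in
theorem homologyMap_iotaHom {H' : ModuleCat.{u} R} {Q' : BoundaryPresentation C' n H'}
    (f : C ⟶ C') (g : D ⟶ D')
    (h : ∀ x, E₂.e n ((f.f n).hom.rTensor A x) = (g.f n).hom (E.e n x))
    {φ : H ⟶ H'} (m : Q.Map Q' f φ) :
    HomologicalComplex.homologyMap g n ≫ E₂.iotaHom Q' =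
      E.iotaHom Q ≫ (torOne.{u, v} R A).map φ :=
  ModuleCat.hom_ext (LinearMap.ext (iota_map f g h m))

end TensorComparison

end UniversalCoefficients

/-! ### The Moore complex as a tensor product -/

namespace AmpleGroupoid

open TensorProduct

variable (G : AmpleGroupoid.{u})

/-- The differential of the Moore complex as a map between groups of functions. -/
noncomputable def mooreD (A : Type v) [AddCommGroup A] [TopologicalSpace A]
    [IsTopologicalAddGroup A] (i j : ℕ) : C_c(G.Nerve i, A) →ₗ[ℤ] C_c(G.Nerve j, A) :=
  ((G.mooreComplex A).d i j).hom

theorem mooreD_succ (A : Type v) [AddCommGroup A] [TopologicalSpace A]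
    [IsTopologicalAddGroup A] (n : ℕ) :
    G.mooreD A (n + 1) n = ∑ i : Fin (n + 2), (-1 : ℤ) ^ (i : ℕ) •
      pushforward (Nerve.simplexMap (SimplexCategory.δ i).toOrderHom)
        (Nerve.isLocalHomeomorph_simplexMap (G := G) (SimplexCategory.δ i).toOrderHom) := by
  have h : (G.mooreComplex A).d (n + 1) n =
      ∑ i : Fin (n + 2), (-1 : ℤ) ^ (i : ℕ) • (G.chains A).δ i :=
    AlgebraicTopology.alternatingFaceMapComplex_obj_d (G.chains A) n
  exact (congrArg ModuleCat.Hom.hom h).trans (ModuleCat.hom_sum _ _)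

theorem mooreD_of_ne (A : Type v) [AddCommGroup A] [TopologicalSpace A]
    [IsTopologicalAddGroup A] {i j : ℕ} (h : j + 1 ≠ i) : G.mooreD A i j = 0 :=
  congrArg ModuleCat.Hom.hom ((G.mooreComplex A).shape i j h)

instance (n : ℕ) : Module.IsTorsionFree ℤ ((G.mooreComplex ℤ).X n) :=
  inferInstanceAs (Module.IsTorsionFree ℤ C_c(G.Nerve n, ℤ))

/-- On a pure tensor `f ⊗ a` this reduces to each face map: multiplying values by `a` is a
coefficient homomorphism `ℤ → A`, and it commutes with pushforward. -/
theorem tensorCoeff_mooreD (A : Type v) [AddCommGroup A] [TopologicalSpace A]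
    [IsTopologicalAddGroup A] (i j : ℕ) (x : C_c(G.Nerve i, ℤ) ⊗[ℤ] A) :
    tensorCoeff (G.Nerve j) A ((G.mooreD ℤ i j).rTensor A x) =
      G.mooreD A i j (tensorCoeff (G.Nerve i) A x) := by
  by_cases hij : j + 1 = i
  · subst hij
    induction x with
    | zero => simp only [map_zero]
    | add z w hz hw => simp only [map_add, hz, hw]
    | tmul f a =>
      rw [LinearMap.rTensor_tmul, tensorCoeff_tmul, tensorCoeff_tmul, mooreD_succ, mooreD_succ,
        LinearMap.sum_apply, LinearMap.sum_apply, map_sum]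
      refine Finset.sum_congr rfl fun k _ => ?_
      rw [LinearMap.smul_apply, LinearMap.smul_apply, map_smul]
      exact congrArg _ (coeffMap_pushforward
        (Nerve.isLocalHomeomorph_simplexMap (G := G) (SimplexCategory.δ k).toOrderHom)
        (zmultiplesHom A a) continuous_of_discreteTopology f)
  · rw [mooreD_of_ne _ _ hij, mooreD_of_ne _ _ hij, LinearMap.rTensor_zero, LinearMap.zero_apply,
      LinearMap.zero_apply, map_zero]

/-- The identification of `C_c(G_•, A)` with `C_c(G_•, ℤ) ⊗ A`. -/
noncomputable def tensorComparison (A : Type v) [AddCommGroup A] [TopologicalSpace A]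
    [DiscreteTopology A] :
    TensorComparison.{u, v} (G.mooreComplex ℤ) A (G.mooreComplex A) where
  e n := tensorCoeffEquiv (G.Nerve n) A
  comm := G.tensorCoeff_mooreD A

/-- The presentation of `H_{n-1}(G; ℤ)` by the boundary map. -/
noncomputable def boundaryPresentation :
    (n : ℕ) → BoundaryPresentation (G.mooreComplex ℤ) n (G.predHomology n)
  | 0 => BoundaryPresentation.zero _
  | n + 1 => BoundaryPresentation.succ _ n

variable {G} {H : AmpleGroupoid.{u}}

/-- The chain map induced by an étale homomorphism. -/
noncomputable def EtaleHom.chainMap (P : EtaleHom G H) (A : Type v) [AddCommGroup A]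
    [TopologicalSpace A] [IsTopologicalAddGroup A] : G.mooreComplex A ⟶ H.mooreComplex A :=
  (AlgebraicTopology.alternatingFaceMapComplex _).map
    (X := G.chains A) (Y := H.chains A)
    { app := fun Δ => ModuleCat.ofHom
        (pushforward (P.nerveMap Δ.unop.len) (P.isLocalHomeomorph_nerveMap Δ.unop.len))
      naturality := fun _ _ θ => by
        have h := (P.isLocalHomeomorph_nerveMap _).comp
          (Nerve.isLocalHomeomorph_simplexMap (G := G) θ.unop.toOrderHom)
        ext f : 2
        exact (pushforward_comp (Nerve.isLocalHomeomorph_simplexMap θ.unop.toOrderHom)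
          (P.isLocalHomeomorph_nerveMap _) h rfl f).symm.trans
          (pushforward_comp (P.isLocalHomeomorph_nerveMap _)
            (Nerve.isLocalHomeomorph_simplexMap θ.unop.toOrderHom) h rfl f) }

/-- The morphism of presentations induced by an étale homomorphism. -/
noncomputable def EtaleHom.presentationMap (P : EtaleHom G H) : (n : ℕ) →
    (G.boundaryPresentation n).Map (H.boundaryPresentation n) (P.chainMap ℤ) (P.predHomologyMap n)
  | 0 => BoundaryPresentation.Map.zero _
  | n + 1 => BoundaryPresentation.Map.succ _ n

variable (G) in
/-- The chain map induced by a homomorphism of coefficient groups. -/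
noncomputable def coeffChainMap {A B : Type v} [AddCommGroup A] [TopologicalSpace A]
    [IsTopologicalAddGroup A] [AddCommGroup B] [TopologicalSpace B] [IsTopologicalAddGroup B]
    (α : A →+ B) (hα : Continuous α) : G.mooreComplex A ⟶ G.mooreComplex B :=
  (AlgebraicTopology.alternatingFaceMapComplex _).map
    (X := G.chains A) (Y := G.chains B)
    { app := fun Δ => ModuleCat.ofHom (coeffMap (G.Nerve Δ.unop.len) α hα)
      naturality := fun _ _ θ => by
        ext f : 2
        exact coeffMap_pushforward (Nerve.isLocalHomeomorph_simplexMap θ.unop.toOrderHom) α hα f }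

end AmpleGroupoid

end AmpleUCT

open AmpleUCT
theorem mainTheorem1 (n : ℕ) :
    ∃ (κ : ∀ (G : AmpleGroupoid.{u}) (A : Type v) [AddCommGroup A] [TopologicalSpace A]
          [DiscreteTopology A],
          (tensorFunctor.{u, v} ℤ A).obj (G.homology ℤ n) ⟶ G.homology A n)
      (ι : ∀ (G : AmpleGroupoid.{u}) (A : Type v) [AddCommGroup A] [TopologicalSpace A]
          [DiscreteTopology A],
          G.homology A n ⟶ (torOne.{u, v} ℤ A).obj (G.predHomology n)),
      -- exactness of `0 → H_n(G; ℤ) ⊗ A → H_n(G; A) → Tor₁(H_{n-1}(G; ℤ), A) → 0`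
      (∀ (G : AmpleGroupoid.{u}) (A : Type v) [AddCommGroup A] [TopologicalSpace A]
          [DiscreteTopology A],
        Function.Injective (κ G A).hom ∧ Function.Exact (κ G A).hom (ι G A).hom ∧
          Function.Surjective (ι G A).hom) ∧
      -- naturality in `A`
      (∀ (G : AmpleGroupoid.{u}) (A B : Type v) [AddCommGroup A] [TopologicalSpace A]
          [DiscreteTopology A] [AddCommGroup B] [TopologicalSpace B] [DiscreteTopology B]
          (α : A →+ B),
        (tensorFunctorMap.{u, v} α.toIntLinearMap).app (G.homology ℤ n) ≫ κ G B =
            κ G A ≫ G.homologyCoeffMap α continuous_of_discreteTopology n ∧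
          G.homologyCoeffMap α continuous_of_discreteTopology n ≫ ι G B =
            ι G A ≫ (torOneMap.{u, v} α.toIntLinearMap).app (G.predHomology n)) ∧
      -- naturality in `G`
      (∀ (G H : AmpleGroupoid.{u}) (P : AmpleGroupoid.EtaleHom G H) (A : Type v)
          [AddCommGroup A] [TopologicalSpace A] [DiscreteTopology A],
        (tensorFunctor.{u, v} ℤ A).map (P.homologyMap ℤ n) ≫ κ H A =
            κ G A ≫ P.homologyMap A n ∧
          P.homologyMap A n ≫ ι H A =
            ι G A ≫ (torOne.{u, v} ℤ A).map (P.predHomologyMap n)) := by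
  refine ⟨fun G A _ _ _ => (G.tensorComparison A).kappaHom n,
    fun G A _ _ _ => (G.tensorComparison A).iotaHom (G.boundaryPresentation n), ?_, ?_, ?_⟩
  · intro G A _ _ _
    exact ⟨TensorComparison.kappa_injective _ n, TensorComparison.exact_kappa_iota _ _,
      TensorComparison.iota_surjective _ _⟩
  · intro G A B _ _ _ _ _ _ α
    -- Only compatibility of the chain-level identifications has to be checked; `homologyCoeffMap`
    -- is by definition the homology map of `coeffChainMap`, and `EtaleHom.homologyMap` below that
    -- of `chainMap`.
    have h : ∀ x, (G.tensorComparison B).e n (α.toIntLinearMap.lTensor _ x) =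
        ((G.coeffChainMap α continuous_of_discreteTopology).f n).hom
          ((G.tensorComparison A).e n x) :=
      tensorCoeff_lTensor α continuous_of_discreteTopology
    exact ⟨TensorComparison.tensorFunctorMap_app_kappaHom _ _ h,
      TensorComparison.homologyMap_iotaHom_coeff _ _ _ h⟩
  · intro G H P A _ _ _
    have h : ∀ x, (H.tensorComparison A).e n (((P.chainMap ℤ).f n).hom.rTensor A x) =
        ((P.chainMap A).f n).hom ((G.tensorComparison A).e n x) :=
      tensorCoeff_pushforward (P.isLocalHomeomorph_nerveMap n)
    exact ⟨TensorComparison.tensorFunctor_map_kappaHom _ _ h,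
      TensorComparison.homologyMap_iotaHom _ _ h (P.presentationMap n)⟩
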